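/- **Setting.** Let $Y_1,\dots,Y_n$ be independent real random variables and let $\Psi_1,\dots,\Psi_n\in\mathbb R^p$ ($p\ge1$) be deterministic vectors such that $V_0^2:=\frac14\sum_i\Psi_i\Psi_i^{\top}$ is positive definite. Put $$L(\theta)=-\tfrac12\sum_{i=1}^n|Y_i-\Psi_i^{\top}\theta|,\qquad L(\theta,\theta')=L(\theta)-L(\theta'),$$ let $\tilde\theta$ be any maximizer of $L$ over $\mathbb R^p$ (the LAD estimator), and let $\theta^*$ be a maximizer of $\mathbb E L(\theta)$, that is, $\mathbb E L(\theta,\theta^*)\le 0$ for all $\theta$. Suppose that each residual $Y_i-\Psi_i^{\top}\theta^*$ has a density $p_i$, and put $$D_0^2=\sum_i p_i(0)\,\Psi_i\Psi_i^{\top},\qquad \xi=D_0^{-1}\nabla L(\theta^*),\qquad N^{-1/2}=\max_i\sup_{\gamma\in\mathbb R^p,\ \gamma\ne0}\frac{\Psi_i^{\top}\gamma}{2\|V_0\gamma\|},$$ where $V_0$ and $D_0$ are the positive definite square roots of $V_0^2$ and $D_0^2$. **Theorem.** For all constants $C>0$ and $\mathfrak a>0$ there are constants $C_2>0$, $K>0$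 and a function $\kappa:\mathbb R\to\mathbb R$ with $\kappa(t)\to0$ as $t\to\infty$, all depending only on $C$ and $\mathfrak a$, such that the following holds for all $n$, $p$, all $\Psi_i$, $Y_i$, $\theta^*$ and $p_i$ as above, and all $\rho>0$, $0<\delta<1/2$, $x>0$. Suppose that for all $i$ $$\sup_u p_i(u)\le C,\qquad p_i(0)\ge\mathfrak a^2/4,\qquad \Bigl|\frac{p_i(u)}{p_i(0)}-1\Bigr|\le\delta\quad\text{for } |u|\le\rho,$$ and that $N\ge C_2\,\rho^{-2}\mathfrak a^2(x+p)$. Then there is an event of probability at least $1-e^{-x}$ on which every LAD estimator $\tilde\theta$ satisfies $$\bigl\|D_0(\tilde\theta-\theta^*)-\xi\bigr\|^2\le\Bigl(K\delta+\kappa\bigl(\tfrac{N}{x+p}\bigr)\Bigr)(x+p),\qquad \bigl|2L(\tilde\theta,\theta^*)-\|\xi\|^2\bigr|\le\Bigl(K\delta+\kappa\bigl(\tfrac{N}{x+p}\bigr)\Bigr)(x+p).$$ In particular, for fixed $x$, $C$, $\mathfrak a$ both errors are $o(p)$ as $N/p\to\infty$ and $\delta\to0$. -/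

import Mathlib

open MeasureTheory ProbabilityTheory Filter Topology

namespace LAD

noncomputable section

/-- The Laplace quasi log-likelihood `L(θ) = -(1/2) ∑ |yᵢ - Ψᵢᵀ θ|` of the linear model with
features `Ψᵢ` at the data `y`. Its maximizers are the least absolute deviation estimates. -/
def logLik {n p : ℕ} (Ψ : Fin n → EuclideanSpace ℝ (Fin p)) (y : Fin n → ℝ)
    (θ : EuclideanSpace ℝ (Fin p)) : ℝ :=
  -(1 / 2) * ∑ i, |y i - inner ℝ (Ψ i) θ|

/-- `V₀² = (1/4) ∑ Ψᵢ Ψᵢᵀ`. -/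
def V0sq {n p : ℕ} (Ψ : Fin n → EuclideanSpace ℝ (Fin p)) : Matrix (Fin p) (Fin p) ℝ :=
  (1 / 4 : ℝ) • ∑ i, Matrix.vecMulVec (Ψ i).ofLp (Ψ i).ofLp

/-- `D₀² = ∑ dᵢ(0) Ψᵢ Ψᵢᵀ`, where `dᵢ` is the density of the `i`-th residual. -/
def D0sq {n p : ℕ} (Ψ : Fin n → EuclideanSpace ℝ (Fin p)) (dens : Fin n → ℝ → ℝ) :
    Matrix (Fin p) (Fin p) ℝ :=
  ∑ i, dens i 0 • Matrix.vecMulVec (Ψ i).ofLp (Ψ i).ofLp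

open scoped MatrixOrder in
/-- The positive semidefinite square root of a positive semidefinite real matrix. -/
def posSqrt {p : ℕ} (M : Matrix (Fin p) (Fin p) ℝ) : Matrix (Fin p) (Fin p) ℝ :=
  CFC.sqrt M

open scoped MatrixOrder in
theorem posSqrt_posSemidef {p : ℕ} (M : Matrix (Fin p) (Fin p) ℝ) :
    (posSqrt M).PosSemidef :=
  Matrix.nonneg_iff_posSemidef.mp (CFC.sqrt_nonneg M)

open scoped MatrixOrder in
theorem posSqrt_mul_self {p : ℕ} {M : Matrix (Fin p) (Fin p) ℝ} (hM : M.PosSemidef) :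
    posSqrt M * posSqrt M = M :=
  CFC.sqrt_mul_sqrt_self M (Matrix.nonneg_iff_posSemidef.mpr hM)

/-- `V₀`, the square root of `V₀²`. -/
def V0 {n p : ℕ} (Ψ : Fin n → EuclideanSpace ℝ (Fin p)) : Matrix (Fin p) (Fin p) ℝ :=
  posSqrt (V0sq Ψ)

/-- `D₀`, the square root of `D₀²`. -/
def D0 {n p : ℕ} (Ψ : Fin n → EuclideanSpace ℝ (Fin p)) (dens : Fin n → ℝ → ℝ) :
    Matrix (Fin p) (Fin p) ℝ :=
  posSqrt (D0sq Ψ dens)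

/-- A matrix acting on Euclidean space. -/
def act {p : ℕ} (M : Matrix (Fin p) (Fin p) ℝ) (v : EuclideanSpace ℝ (Fin p)) :
    EuclideanSpace ℝ (Fin p) :=
  WithLp.toLp 2 (M.mulVec v.ofLp)

/-- The effective sample size `N`, defined by
`N^{-1/2} = max_i sup_γ Ψᵢᵀ γ / (2 ‖V₀ γ‖)`.  For `V₀² > 0` the suprema are finite, and the
convention `0 / 0 = 0` at `γ = 0` does not change them. -/
def effN {n p : ℕ} (Ψ : Fin n → EuclideanSpace ℝ (Fin p)) : ℝ :=
  ((⨆ i, ⨆ γ : EuclideanSpace ℝ (Fin p), inner ℝ (Ψ i) γ / (2 * ‖act (V0 Ψ) γ‖)) ^ 2)⁻¹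

/-- The normalized score `ξ = D₀⁻¹ ∇L(θ*)` at the data `y`. -/
def score {n p : ℕ} (Ψ : Fin n → EuclideanSpace ℝ (Fin p)) (dens : Fin n → ℝ → ℝ)
    (θs : EuclideanSpace ℝ (Fin p)) (y : Fin n → ℝ) : EuclideanSpace ℝ (Fin p) :=
  act (D0 Ψ dens)⁻¹ (gradient (logLik Ψ y) θs)

end

end LAD

/-!
In the coordinates `u = D₀ (θ - θ*)` the likelihood increment is `⟪ξ, u⟫ - f u`, where `ξ` is the
score and `f` is a sum of convex nonnegative remainders of `t ↦ |e - t| / 2`. The remainder at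
shift `t` vanishes for `|e| > |t|`, and its Lebesgue integral over `e` is `t ^ 2 / 2`, so the
flatness of the densities near `0` gives `E f u ≈ ‖u‖ ^ 2 / 2` up to a relative error `δ`. For large
`N` all shifts on the ball of radius of order `√(x + p)` are small; the exponential Markov
inequality and a union bound over a net then give `f u ≈ ‖u‖ ^ 2 / 2` on the net, and convexity
extends this to the ball, because a convex function bounded on a net is Lipschitz. A subgaussian
bound over a net places `ξ` well inside the ball. A maximizer of `⟪ξ, u⟫ - f u` then lies in the
ball by convexity, and comparing it with `u = ξ` yields both expansions.
-/

namespace LAD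

noncomputable section

section Concentration

variable {Ω ι : Type*} [Fintype ι] [MeasurableSpace Ω] {P : Measure Ω} [IsProbabilityMeasure P]
  {X : ι → Ω → ℝ}

theorem mgf_le_of_abs_le {X : Ω → ℝ} (hX : Measurable X) {c l : ℝ} (hb : ∀ ω, |X ω| ≤ c)
    (hl : 0 ≤ l) (hlc : l * c ≤ 1) :
    mgf X P l ≤ Real.exp (l * ∫ ω, X ω ∂P + l ^ 2 * ∫ ω, X ω ^ 2 ∂P) := by
  have hint : Integrable X P := .of_bound hX.aestronglyMeasurable c (.of_forall hb)
  have hint_sq : Integrable (fun ω => X ω ^ 2) P := by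
    refine .of_bound (hX.pow_const 2).aestronglyMeasurable (c ^ 2) (.of_forall fun ω => ?_)
    rw [norm_pow]
    exact pow_le_pow_left₀ (norm_nonneg _) (hb ω) 2
  have hexp : ∀ ω, Real.exp (l * X ω) ≤ 1 + l * X ω + l ^ 2 * X ω ^ 2 := fun ω => by
    have hlX : |l * X ω| ≤ 1 := by
      rw [abs_mul, abs_of_nonneg hl]
      exact (mul_le_mul_of_nonneg_left (hb ω) hl).trans hlc
    linarith [(abs_le.1 (Real.abs_exp_sub_one_sub_id_le hlX)).2, mul_pow l (X ω) 2]
  have hint_lin : Integrable (fun ω => 1 + l * X ω) P :=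
    (integrable_const 1).add (hint.const_mul l)
  calc mgf X P l ≤ ∫ ω, (1 + l * X ω + l ^ 2 * X ω ^ 2) ∂P :=
        integral_mono_of_nonneg (.of_forall fun ω => (Real.exp_pos _).le)
          (hint_lin.add (hint_sq.const_mul _)) (.of_forall hexp)
    _ = l * ∫ ω, X ω ∂P + l ^ 2 * ∫ ω, X ω ^ 2 ∂P + 1 := by
        rw [integral_add hint_lin (hint_sq.const_mul _),
          integral_add (integrable_const 1) (hint.const_mul l), integral_const_mul,
          integral_const_mul, integral_const, probReal_univ, one_smul]
        ring
    _ ≤ _ := Real.add_one_le_exp _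

theorem measureReal_sum_sub_mean_ge_le (hX : ∀ i, Measurable (X i)) (hind : iIndepFun X P)
    {c l v : ℝ} (hb : ∀ i ω, |X i ω| ≤ c) (hl : 0 ≤ l) (hlc : l * c ≤ 1)
    (hv : ∑ i, ∫ ω, X i ω ^ 2 ∂P ≤ v) (τ : ℝ) :
    P.real {ω | τ ≤ ∑ i, X i ω - ∑ i, ∫ ω', X i ω' ∂P} ≤ Real.exp (-l * τ + l ^ 2 * v) := by
  set m := ∑ i, ∫ ω', X i ω' ∂P with hm
  have hset : {ω | τ ≤ ∑ i, X i ω - m} = {ω | τ + m ≤ (∑ i, X i) ω} := by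
    ext ω
    simp only [Set.mem_ofPred_eq, Finset.sum_apply, le_sub_iff_add_le]
  have hint : Integrable (fun ω => Real.exp (l * (∑ i, X i) ω)) P := by
    simp only [Finset.sum_apply]
    refine .of_bound (Measurable.aestronglyMeasurable (by fun_prop))
      (Real.exp (l * ∑ _i : ι, c)) (.of_forall fun ω => ?_)
    rw [Real.norm_of_nonneg (Real.exp_pos _).le]
    gcongr with i
    exact (le_abs_self _).trans (hb i ω)
  calc P.real {ω | τ ≤ ∑ i, X i ω - m}
      ≤ Real.exp (-l * (τ + m)) * mgf (∑ i, X i) P l :=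
        hset ▸ measure_ge_le_exp_mul_mgf (τ + m) hl hint
    _ = Real.exp (-l * (τ + m)) * ∏ i, mgf (X i) P l := by rw [hind.mgf_sum hX]
    _ ≤ Real.exp (-l * (τ + m)) *
          ∏ i, Real.exp (l * ∫ ω, X i ω ∂P + l ^ 2 * ∫ ω, X i ω ^ 2 ∂P) := by
        gcongr with i _
        · exact fun i _ => mgf_nonneg
        · exact mgf_le_of_abs_le (hX i) (hb i) hl hlc
    _ = Real.exp (-l * τ + l ^ 2 * ∑ i, ∫ ω, X i ω ^ 2 ∂P) := by
        rw [← Real.exp_sum, ← Real.exp_add, Finset.sum_add_distrib, ← Finset.mul_sum,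
          ← Finset.mul_sum, ← hm]
        ring_nf
    _ ≤ Real.exp (-l * τ + l ^ 2 * v) := by gcongr

theorem measureReal_abs_sum_sub_mean_ge_le (hX : ∀ i, Measurable (X i)) (hind : iIndepFun X P)
    {c l v : ℝ} (hb : ∀ i ω, |X i ω| ≤ c) (hl : 0 ≤ l) (hlc : l * c ≤ 1)
    (hv : ∑ i, ∫ ω, X i ω ^ 2 ∂P ≤ v) (τ : ℝ) :
    P.real {ω | τ ≤ |∑ i, X i ω - ∑ i, ∫ ω', X i ω' ∂P|}
      ≤ 2 * Real.exp (-l * τ + l ^ 2 * v) := by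
  have hlower : P.real {ω | τ ≤ -(∑ i, X i ω - ∑ i, ∫ ω', X i ω' ∂P)}
      ≤ Real.exp (-l * τ + l ^ 2 * v) := by
    have h := measureReal_sum_sub_mean_ge_le (P := P) (X := fun i ω => -X i ω) (v := v)
      (fun i => (hX i).neg) (hind.comp (fun _ y => -y) fun _ => measurable_neg)
      (fun i ω => (abs_neg (X i ω)).trans_le (hb i ω)) hl hlc
      (by simpa only [neg_sq] using hv) τ
    simpa only [Finset.sum_neg_distrib, integral_neg, sub_neg_eq_add, neg_sub', add_comm] using h
  calc P.real {ω | τ ≤ |∑ i, X i ω - ∑ i, ∫ ω', X i ω' ∂P|}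
      = P.real ({ω | τ ≤ ∑ i, X i ω - ∑ i, ∫ ω', X i ω' ∂P} ∪
          {ω | τ ≤ -(∑ i, X i ω - ∑ i, ∫ ω', X i ω' ∂P)}) := by
        congr 1
        ext ω
        simp only [Set.mem_ofPred_eq, Set.mem_union, le_abs]
    _ ≤ _ := (measureReal_union_le _ _).trans
        (by linarith [measureReal_sum_sub_mean_ge_le hX hind hb hl hlc hv τ])

theorem measureReal_sum_sub_mean_ge_le_of_sum_sq_le (hX : ∀ i, Measurable (X i))
    (hind : iIndepFun X P) {b : ι → ℝ} (hb : ∀ i ω, |X i ω| ≤ b i) {v τ : ℝ}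
    (hbv : ∑ i, b i ^ 2 ≤ v) (hτ : 0 ≤ τ) :
    P.real {ω | τ ≤ ∑ i, X i ω - ∑ i, ∫ ω', X i ω' ∂P} ≤ Real.exp (-τ ^ 2 / (2 * v)) := by
  have hsub : ∀ i, HasSubgaussianMGF (fun ω => X i ω - ∫ ω', X i ω' ∂P) (‖b i‖₊ ^ 2) P := by
    intro i
    have h := hasSubgaussianMGF_of_mem_Icc (hX i).aemeasurable
      (.of_forall fun ω => abs_le.1 (hb i ω) : ∀ᵐ ω ∂P, X i ω ∈ Set.Icc (-b i) (b i))
    rwa [sub_neg_eq_add, ← two_mul, nnnorm_mul, Real.nnnorm_two, mul_div_cancel_left₀ _ two_ne_zero]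
      at h
  have hsum := HasSubgaussianMGF.sum_of_iIndepFun (s := Finset.univ)
    (hind.comp (fun i y => y - ∫ ω', X i ω' ∂P) fun i => measurable_id.sub_const _)
    fun i _ => hsub i
  lift v to NNReal using (Finset.sum_nonneg fun i _ => sq_nonneg (b i)).trans hbv
  have hsum_v : HasSubgaussianMGF (fun ω => ∑ i, (X i ω - ∫ ω', X i ω' ∂P)) v P :=
    ⟨hsum.integrable_exp_mul, fun t => (hsum.mgf_le t).trans (by
      gcongr
      rw [← NNReal.coe_le_coe]
      simpa using hbv)⟩
  simpa only [Finset.sum_sub_distrib] using hsum_v.measure_ge_le hτ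

end Concentration

section Net

open Metric

variable {E : Type*} [NormedAddCommGroup E] [NormedSpace ℝ E] {R d : ℝ} {s : Finset E}

theorem card_le_of_pairwise_lt_dist [FiniteDimensional ℝ E] (hR : 0 ≤ R) (hd : 0 < d)
    (hs : (s : Set E) ⊆ closedBall 0 R) (hsep : (s : Set E).Pairwise fun g h => d < dist g h) :
    (s.card : ℝ) ≤ (1 + 2 * R / d) ^ Module.finrank ℝ E := by
  borelize E
  let μ : Measure E := Measure.addHaar
  have hdisj : (s : Set E).PairwiseDisjoint fun g => closedBall g (d / 2) := fun g hg h hh hgh =>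
    closedBall_disjoint_closedBall (by linarith [hsep hg hh hgh])
  have hsub : (⋃ g ∈ s, closedBall g (d / 2)) ⊆ closedBall (0 : E) (R + d / 2) :=
    Set.iUnion₂_subset fun g hg => closedBall_subset_closedBall' (by
      linarith [mem_closedBall.1 (hs hg)])
  have hvol : s.card * (d / 2) ^ Module.finrank ℝ E * μ.real (ball 0 1)
      ≤ (R + d / 2) ^ Module.finrank ℝ E * μ.real (ball 0 1) := by
    calc s.card * (d / 2) ^ Module.finrank ℝ E * μ.real (ball 0 1)
        = μ.real (⋃ g ∈ s, closedBall g (d / 2)) := by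
          rw [measureReal_biUnion_finset hdisj (fun g _ => measurableSet_closedBall)
            fun g _ => measure_closedBall_lt_top.ne]
          simp only [μ.addHaar_real_closedBall _ (half_pos hd).le, Finset.sum_const, nsmul_eq_mul,
            mul_assoc]
      _ ≤ μ.real (closedBall (0 : E) (R + d / 2)) :=
          measureReal_mono hsub measure_closedBall_lt_top.ne
      _ = _ := μ.addHaar_real_closedBall 0 (by positivity)
  have hcard := le_of_mul_le_mul_right hvol
    (ENNReal.toReal_pos (measure_ball_pos μ _ one_pos).ne' measure_ball_lt_top.ne)
  rwa [show 1 + 2 * R / d = (R + d / 2) / (d / 2) by field_simp; ring, div_pow,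
    le_div_iff₀ (by positivity)]

theorem exists_net_closedBall (E : Type*) [NormedAddCommGroup E] [NormedSpace ℝ E]
    [FiniteDimensional ℝ E] {R d : ℝ} (hR : 0 ≤ R) (hd : 0 < d) :
    ∃ s : Finset E, (s : Set E) ⊆ closedBall 0 R ∧ closedBall 0 R ⊆ ⋃ g ∈ s, closedBall g d ∧
      (s.card : ℝ) ≤ Real.exp (2 * R / d * Module.finrank ℝ E) := by
  lift d to NNReal using hd.le
  have hd2 : d / 2 ≠ 0 := (half_pos (NNReal.coe_pos.1 hd)).ne'
  have hpack : packingNumber d (closedBall (0 : E) R) ≠ ⊤ := by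
    obtain ⟨N, -, hN, hcover⟩ :=
      exists_finite_isCover_of_isCompact hd2 (isCompact_closedBall (0 : E) R)
    have h := (packingNumber_two_mul_le_externalCoveringNumber _ _).trans
      hcover.externalCoveringNumber_le_encard
    rw [mul_div_cancel₀ _ two_ne_zero] at h
    exact (h.trans_lt (Set.encard_lt_top_iff.2 hN)).ne
  have hfin : (maximalSeparatedSet d (closedBall (0 : E) R)).Finite := by
    rwa [← Set.encard_ne_top_iff, encard_maximalSeparatedSet hpack]
  refine ⟨hfin.toFinset, by simpa using maximalSeparatedSet_subset,
    by simpa using (isCover_maximalSeparatedSet hpack).subset_iUnion_closedBall, ?_⟩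
  calc (hfin.toFinset.card : ℝ) ≤ (1 + 2 * R / d) ^ Module.finrank ℝ E := by
        refine card_le_of_pairwise_lt_dist hR hd (by simpa using maximalSeparatedSet_subset)
          fun g hg h hh hgh => ?_
        have hlt : (d : ENNReal) < edist g h := isSeparated_maximalSeparatedSet
          (hfin.mem_toFinset.1 hg) (hfin.mem_toFinset.1 hh) hgh
        rwa [edist_nndist, ENNReal.coe_lt_coe] at hlt
    _ ≤ Real.exp (2 * R / d) ^ Module.finrank ℝ E := by
        gcongr
        linarith [Real.add_one_le_exp (2 * R / d)]
    _ = Real.exp (2 * R / d * Module.finrank ℝ E) := by rw [← Real.exp_nat_mul, mul_comm]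

theorem sub_mul_norm_le_of_net (hR : 0 < R) (hnet : closedBall 0 R ⊆ ⋃ g ∈ s, closedBall g d)
    {φ : StrongDual ℝ E} {c : ℝ} (hφ : ∀ g ∈ s, φ g ≤ c) : (R - d) * ‖φ‖ ≤ c := by
  have hle : ∀ u ∈ closedBall (0 : E) R, φ u ≤ c + ‖φ‖ * d := fun u hu => by
    obtain ⟨g, hg, hug⟩ := Set.mem_iUnion₂.1 (hnet hu)
    have h : φ (u - g) ≤ ‖φ‖ * d :=
      (le_abs_self _).trans ((φ.le_opNorm _).trans (by gcongr; rwa [← dist_eq_norm]))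
    rw [map_sub] at h
    linarith [hφ g hg]
  have hnorm : ‖φ‖ ≤ (c + ‖φ‖ * d) / R :=
    ContinuousLinearMap.opNorm_bound_of_ball_bound hR _ φ fun u hu =>
      abs_le'.2 ⟨hle u hu, by simpa using hle (-u) (by simpa using hu)⟩
  rw [le_div_iff₀ hR] at hnorm
  linarith

theorem closedBall_subset_convexHull_of_net (hR : 0 < R)
    (hnet : closedBall 0 R ⊆ ⋃ g ∈ s, closedBall g d) :
    closedBall 0 (R - d) ⊆ convexHull ℝ (s : Set E) := by
  intro u hu
  by_contra hconv
  obtain ⟨φ, c, hφ, hc⟩ := geometric_hahn_banach_closed_point (convex_convexHull ℝ _)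
    (s.finite_toSet.isCompact_convexHull (𝕜 := ℝ)).isClosed hconv
  have hnorm := sub_mul_norm_le_of_net hR hnet fun g hg => (hφ g (subset_convexHull ℝ _ hg)).le
  have hφu : φ u ≤ ‖φ‖ * (R - d) :=
    (le_abs_self _).trans ((φ.le_opNorm u).trans (by gcongr; exact mem_closedBall_zero_iff.1 hu))
  linarith

/-- The maximum of a convex function over a convex hull is attained at a vertex, so that a bound
on the net is a bound on a ball. -/
theorem lipschitzOnWith_of_le_on_net (hR : 0 < R)
    (hnet : closedBall 0 R ⊆ ⋃ g ∈ s, closedBall g d) {f : E → ℝ} (hf : ConvexOn ℝ Set.univ f)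
    (hf0 : ∀ u, 0 ≤ f u) {M : ℝ} (hfM : ∀ g ∈ s, f g ≤ M) {η : ℝ} (hη : 0 < η) :
    LipschitzOnWith (2 * M / η).toNNReal f (ball 0 (R - d - η)) := by
  refine (hf.subset (Set.subset_univ _) (convex_ball 0 (R - d))).lipschitzOnWith_of_abs_le hη
    fun u hu => ?_
  obtain ⟨g, hg, hug⟩ := hf.exists_ge_of_mem_convexHull (Set.subset_univ _)
    (closedBall_subset_convexHull_of_net hR hnet (mem_closedBall.2 hu.le))
  exact (abs_of_nonneg (hf0 u)).trans_le (hug.trans (hfM g hg))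

end Net

section QuadraticApproximation

open Metric

variable {E : Type*} [NormedAddCommGroup E] {f : E → ℝ}

theorem abs_sub_half_sq_norm_le_of_net [NormedSpace ℝ E] {R ε τ δ : ℝ} (hR : 0 < R) (hε : 0 < ε)
    (hε16 : ε ≤ 1 / 16) (hτ : 0 ≤ τ) (hδ0 : 0 ≤ δ) (hδ1 : δ ≤ 1) {s : Finset E}
    (hs : (s : Set E) ⊆ closedBall 0 R)
    (hnet : closedBall 0 R ⊆ ⋃ g ∈ s, closedBall g (ε * R)) (hf : ConvexOn ℝ Set.univ f)
    (hf0 : ∀ u, 0 ≤ f u) (hfs : ∀ g ∈ s, |f g - ‖g‖ ^ 2 / 2| ≤ δ / 2 * ‖g‖ ^ 2 + τ)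
    {u : E} (hu : ‖u‖ ≤ R / 4) :
    |f u - ‖u‖ ^ 2 / 2| ≤ δ / 2 * ‖u‖ ^ 2 + (5 * ε * R ^ 2 + (1 + 4 * ε) * τ) := by
  have hεR : ε * R ≤ R / 16 := by nlinarith
  have hfM : ∀ g ∈ s, f g ≤ R ^ 2 + τ := fun g hg => by
    have hgR : ‖g‖ ^ 2 ≤ R ^ 2 := by
      gcongr
      exact mem_closedBall_zero_iff.1 (hs hg)
    have hδg : δ * ‖g‖ ^ 2 ≤ 1 * ‖g‖ ^ 2 := by gcongr
    linarith [(abs_le.1 (hfs g hg)).2]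
  obtain ⟨g, hg, hug⟩ := Set.mem_iUnion₂.1 (hnet (mem_closedBall_zero_iff.2 (by linarith)))
  rw [mem_closedBall, dist_eq_norm] at hug
  have hug' : |‖u‖ - ‖g‖| ≤ ε * R := (abs_norm_sub_norm_le u g).trans hug
  have hgR : ‖g‖ ≤ 5 * R / 16 := by linarith [(abs_le.1 hug').1]
  have hlip : |f u - f g| ≤ 4 * ε * (R ^ 2 + τ) := by
    have h := (lipschitzOnWith_of_le_on_net hR hnet hf hf0 hfM (half_pos hR)).dist_le_mul
      u (mem_ball_zero_iff.2 (by linarith)) g (mem_ball_zero_iff.2 (by linarith))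
    rw [Real.dist_eq, dist_eq_norm, Real.coe_toNNReal _ (by positivity)] at h
    calc |f u - f g| ≤ 2 * (R ^ 2 + τ) / (R / 2) * (ε * R) := h.trans (by gcongr)
      _ = 4 * ε * (R ^ 2 + τ) := by field_simp; ring
  have hsq : |‖u‖ ^ 2 - ‖g‖ ^ 2| ≤ ε * R ^ 2 := by
    calc |‖u‖ ^ 2 - ‖g‖ ^ 2| = (‖u‖ + ‖g‖) * |‖u‖ - ‖g‖| := by
          rw [sq_sub_sq, abs_mul, abs_of_nonneg (by positivity)]
      _ ≤ R * (ε * R) := by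
          gcongr
          linarith
      _ = ε * R ^ 2 := by ring
  have hδsq : δ * (‖g‖ ^ 2 - ‖u‖ ^ 2) ≤ ε * R ^ 2 := by
    calc δ * (‖g‖ ^ 2 - ‖u‖ ^ 2) ≤ δ * |‖u‖ ^ 2 - ‖g‖ ^ 2| := by
          gcongr
          rw [abs_sub_comm]
          exact le_abs_self _
      _ ≤ 1 * (ε * R ^ 2) := by gcongr
      _ = ε * R ^ 2 := one_mul _
  have hfg := abs_le.1 (hfs g hg)
  rw [abs_le] at hlip hsq ⊢
  constructor <;> linarith

variable [InnerProductSpace ℝ E] {ξ v : E} {r η : ℝ}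

theorem norm_le_of_isMaxOn_inner_sub (hf : ConvexOn ℝ Set.univ f) (hf0 : f 0 = 0) (hr : 0 < r)
    (hfr : ∀ u, ‖u‖ = r → r ^ 2 / 2 - η ≤ f u) (hξ : ‖ξ‖ * r + η < r ^ 2 / 2)
    (hv : IsMaxOn (fun u => inner ℝ ξ u - f u) Set.univ v) : ‖v‖ ≤ r := by
  by_contra! hvr
  have hv0 : 0 < ‖v‖ := hr.trans hvr
  set c := r / ‖v‖
  have hc0 : 0 < c := by positivity
  have hc1 : c ≤ 1 := (div_le_one hv0).2 hvr.le
  have hcv : ‖c • v‖ = r := by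
    rw [norm_smul, Real.norm_of_nonneg hc0.le, div_mul_cancel₀ _ hv0.ne']
  have hray : f (c • v) ≤ c * f v := by
    simpa [hf0] using
      hf.2 (Set.mem_univ v) (Set.mem_univ 0) hc0.le (sub_nonneg.2 hc1) (add_sub_cancel _ _)
  have hfv : f v ≤ inner ℝ ξ v := by simpa [hf0] using hv (Set.mem_univ 0)
  have hinner : c * inner ℝ ξ v ≤ ‖ξ‖ * r := by
    rw [← inner_smul_right, ← hcv]
    exact real_inner_le_norm _ _
  have hcfv : c * f v ≤ c * inner ℝ ξ v := by gcongr
  linarith [hfr _ hcv]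

theorem sq_norm_sub_le_of_isMaxOn_inner_sub (hη : ∀ u, ‖u‖ ≤ r → |f u - ‖u‖ ^ 2 / 2| ≤ η)
    (hξ : ‖ξ‖ ≤ r) (hvr : ‖v‖ ≤ r) (hv : IsMaxOn (fun u => inner ℝ ξ u - f u) Set.univ v) :
    ‖v - ξ‖ ^ 2 ≤ 4 * η ∧ |2 * (inner ℝ ξ v - f v) - ‖ξ‖ ^ 2| ≤ 2 * η := by
  have hfv := abs_le.1 (hη v hvr)
  have hfξ := abs_le.1 (hη ξ hξ)
  have hmax : inner ℝ ξ ξ - f ξ ≤ inner ℝ ξ v - f v := hv (Set.mem_univ ξ)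
  have hsq : ‖v - ξ‖ ^ 2 = ‖v‖ ^ 2 - 2 * inner ℝ ξ v + ‖ξ‖ ^ 2 := by
    rw [norm_sub_sq_real, real_inner_comm]
  have hsq0 := sq_nonneg ‖v - ξ‖
  rw [real_inner_self_eq_norm_sq] at hmax
  exact ⟨by linarith, abs_le.2 ⟨by linarith, by linarith⟩⟩

/-- The Fisher and Wilks expansions with error `B` for the contrast `u ↦ ⟪ξ, u⟫ - f u`: all its
maximizers are close to `ξ` and its maximal value is close to `‖ξ‖ ^ 2 / 2`. -/
def FisherWilksExpansion (ξ : E) (f : E → ℝ) (B : ℝ) : Prop :=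
  ∀ v, IsMaxOn (fun u => inner ℝ ξ u - f u) Set.univ v →
    ‖v - ξ‖ ^ 2 ≤ B ∧ |2 * (inner ℝ ξ v - f v) - ‖ξ‖ ^ 2| ≤ B

theorem fisherWilksExpansion_of_abs_sub_half_sq_norm_le {w : ℝ} (hf : ConvexOn ℝ Set.univ f)
    (hf0 : f 0 = 0) (hr : 0 < r) (hδ0 : 0 ≤ δ) (hδ2 : δ ≤ 1 / 2)
    (hfw : ∀ u, ‖u‖ ≤ r → |f u - ‖u‖ ^ 2 / 2| ≤ δ / 2 * ‖u‖ ^ 2 + w)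
    (hξ : ‖ξ‖ ≤ r / 8) (hw : w ≤ r ^ 2 / 16) :
    FisherWilksExpansion ξ f (4 * (δ / 2 * r ^ 2 + w)) := by
  intro v hv
  have hη : ∀ u, ‖u‖ ≤ r → |f u - ‖u‖ ^ 2 / 2| ≤ δ / 2 * r ^ 2 + w := fun u hu =>
    (hfw u hu).trans (by gcongr)
  have hvr : ‖v‖ ≤ r := by
    refine norm_le_of_isMaxOn_inner_sub hf hf0 hr (η := δ / 2 * r ^ 2 + w) (fun u hu => ?_) ?_ hv
    · have := (abs_le.1 (hη u hu.le)).1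
      rw [hu] at this
      linarith
    · nlinarith
  obtain ⟨hfisher, hwilks⟩ := sq_norm_sub_le_of_isMaxOn_inner_sub hη (by linarith) hvr hv
  have := (abs_nonneg _).trans hwilks
  exact ⟨hfisher, hwilks.trans (by linarith)⟩

end QuadraticApproximation

section AbsRemainder

/-- A selection of the subdifferential of the absolute value: the sign, with value `-1` at `0`. -/
def sgn (e : ℝ) : ℝ := if 0 < e then 1 else -1

/-- The remainder of the first order expansion of `t ↦ |e - t| / 2` at `t = 0`. -/
def absRemainder (t e : ℝ) : ℝ := 1 / 2 * (|e - t| - |e| + t * sgn e)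

@[fun_prop]
theorem measurable_sgn : Measurable sgn :=
  Measurable.ite measurableSet_Ioi measurable_const measurable_const

theorem abs_sgn (e : ℝ) : |sgn e| = 1 := by
  unfold sgn
  split_ifs <;> simp

@[fun_prop]
theorem measurable_absRemainder (t : ℝ) : Measurable (absRemainder t) := by
  unfold absRemainder
  fun_prop

theorem absRemainder_zero (e : ℝ) : absRemainder 0 e = 0 := by
  simp [absRemainder]

theorem absRemainder_nonneg (t e : ℝ) : 0 ≤ absRemainder t e := by
  unfold absRemainder sgn
  split_ifs <;> grind

theorem absRemainder_le_abs (t e : ℝ) : absRemainder t e ≤ |t| := by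
  unfold absRemainder sgn
  split_ifs <;> grind

theorem absRemainder_eq_zero {t e : ℝ} (h : |t| < |e|) : absRemainder t e = 0 := by
  unfold absRemainder sgn
  split_ifs <;> grind

theorem absRemainder_of_nonneg {t : ℝ} (ht : 0 ≤ t) :
    absRemainder t = (Set.Ioc 0 t).indicator fun e => t - e := by
  ext e
  rw [absRemainder, sgn, Set.indicator_apply]
  simp only [Set.mem_Ioc]
  split_ifs <;> grind

theorem absRemainder_of_nonpos {t : ℝ} (ht : t ≤ 0) :
    absRemainder t = (Set.Ioc t 0).indicator fun e => e - t := by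
  ext e
  rw [absRemainder, sgn, Set.indicator_apply]
  simp only [Set.mem_Ioc]
  split_ifs <;> grind

theorem integrable_absRemainder (t : ℝ) : Integrable (absRemainder t) := by
  rcases le_total 0 t with ht | ht
  · rw [absRemainder_of_nonneg ht, integrable_indicator_iff measurableSet_Ioc]
    exact (Continuous.integrableOn_Icc (by fun_prop)).mono_set Set.Ioc_subset_Icc_self
  · rw [absRemainder_of_nonpos ht, integrable_indicator_iff measurableSet_Ioc]
    exact (Continuous.integrableOn_Icc (by fun_prop)).mono_set Set.Ioc_subset_Icc_self

theorem integral_absRemainder (t : ℝ) : ∫ e, absRemainder t e = t ^ 2 / 2 := by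
  rcases le_total 0 t with ht | ht
  · rw [absRemainder_of_nonneg ht, integral_indicator measurableSet_Ioc,
      ← intervalIntegral.integral_of_le ht, intervalIntegral.integral_sub intervalIntegrable_const
        intervalIntegral.intervalIntegrable_id, integral_id, intervalIntegral.integral_const,
      smul_eq_mul]
    ring
  · rw [absRemainder_of_nonpos ht, integral_indicator measurableSet_Ioc,
      ← intervalIntegral.integral_of_le ht, intervalIntegral.integral_sub
        intervalIntegral.intervalIntegrable_id intervalIntegrable_const, integral_id,
      intervalIntegral.integral_const, smul_eq_mul]
    ring

theorem convexOn_absRemainder (e : ℝ) : ConvexOn ℝ Set.univ fun t => absRemainder t e := by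
  refine ⟨convex_univ, fun x _ y _ a b ha hb hab => ?_⟩
  have habs : |e - (a * x + b * y)| ≤ a * |e - x| + b * |e - y| := by
    rw [show e - (a * x + b * y) = a * (e - x) + b * (e - y) by linear_combination (-e) * hab]
    refine (abs_add_le _ _).trans_eq ?_
    rw [abs_mul, abs_mul, abs_of_nonneg ha, abs_of_nonneg hb]
  have he : |e| = a * |e| + b * |e| := by rw [← add_mul, hab, one_mul]
  simp only [absRemainder, smul_eq_mul]
  linarith

end AbsRemainder

section Density

variable {d : ℝ → ℝ} {c ρ δ t : ℝ}

theorem abs_integral_absRemainder_withDensity_sub_le (hd : Measurable d) (hd0 : ∀ u, 0 ≤ d u)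
    (hdc : ∀ u, |u| ≤ ρ → |d u - c| ≤ δ * c) (ht : |t| ≤ ρ) :
    |∫ e, absRemainder t e ∂(volume.withDensity fun u => ENNReal.ofReal (d u)) - c * t ^ 2 / 2|
      ≤ δ * (c * t ^ 2 / 2) := by
  have hbound : ∀ e, ‖(d e - c) * absRemainder t e‖ ≤ δ * c * absRemainder t e := fun e => by
    rw [Real.norm_eq_abs, abs_mul, abs_of_nonneg (absRemainder_nonneg t e)]
    rcases le_or_gt |e| ρ with he | he
    · exact mul_le_mul_of_nonneg_right (hdc e he) (absRemainder_nonneg t e)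
    · rw [absRemainder_eq_zero (ht.trans_lt he), mul_zero, mul_zero]
  have hint : Integrable fun e => (d e - c) * absRemainder t e :=
    ((integrable_absRemainder t).const_mul (δ * c)).mono'
      (by fun_prop) (.of_forall hbound)
  have hsub : ∫ e, absRemainder t e ∂(volume.withDensity fun u => ENNReal.ofReal (d u))
      - c * t ^ 2 / 2 = ∫ e, (d e - c) * absRemainder t e := by
    rw [integral_withDensity_eq_integral_toReal_smul hd.ennreal_ofReal
      (.of_forall fun _ => ENNReal.ofReal_lt_top), mul_div_assoc, ← integral_absRemainder,
      ← integral_const_mul, sub_eq_iff_eq_add,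
      ← integral_add hint ((integrable_absRemainder t).const_mul c)]
    exact integral_congr_ae (.of_forall fun e => by
      simp only [ENNReal.toReal_ofReal (hd0 e), smul_eq_mul]; ring)
  rw [hsub, ← Real.norm_eq_abs, mul_div_assoc, ← mul_assoc, ← integral_absRemainder,
    ← integral_const_mul]
  exact norm_integral_le_of_norm_le ((integrable_absRemainder t).const_mul _) (.of_forall hbound)

theorem two_mul_mul_le_one_of_le_density {f : ℝ → ENNReal}
    [IsProbabilityMeasure (volume.withDensity f)]
    (hc : 0 ≤ c) (hf : ∀ u, |u| ≤ ρ → ENNReal.ofReal c ≤ f u) : 2 * ρ * c ≤ 1 := by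
  rw [← ENNReal.ofReal_le_one]
  calc ENNReal.ofReal (2 * ρ * c)
      = ∫⁻ _u in Set.Icc (-ρ) ρ, ENNReal.ofReal c := by
        rw [setLIntegral_const, Real.volume_Icc, ← ENNReal.ofReal_mul hc]
        ring_nf
    _ ≤ ∫⁻ u in Set.Icc (-ρ) ρ, f u :=
        setLIntegral_mono' measurableSet_Icc fun u hu => hf u (abs_le.2 hu)
    _ = volume.withDensity f (Set.Icc (-ρ) ρ) := (withDensity_apply _ measurableSet_Icc).symm
    _ ≤ 1 := prob_le_one

end Density

section Sums

variable {E ι : Type*} [NormedAddCommGroup E] [InnerProductSpace ℝ E] [Fintype ι] (α : ι → E)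

/-- The score of the least absolute deviation contrast with features `α` at the residuals `e`. -/
def absScore (e : ι → ℝ) : E := (1 / 2 : ℝ) • ∑ i, sgn (e i) • α i

/-- The remainder of the first order expansion of `u ↦ 1/2 ∑ |eᵢ - ⟪αᵢ, u⟫|` at `u = 0`. -/
def absRemainderSum (e : ι → ℝ) (u : E) : ℝ := ∑ i, absRemainder (inner ℝ (α i) u) (e i)

theorem inner_absScore (e : ι → ℝ) (u : E) :
    inner ℝ (absScore α e) u = ∑ i, 1 / 2 * (sgn (e i) * inner ℝ (α i) u) := by
  simp [absScore, inner_smul_left, sum_inner, Finset.mul_sum]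

theorem absRemainderSum_zero (e : ι → ℝ) : absRemainderSum α e 0 = 0 := by
  simp [absRemainderSum, absRemainder_zero]

theorem absRemainderSum_nonneg (e : ι → ℝ) (u : E) : 0 ≤ absRemainderSum α e u :=
  Finset.sum_nonneg fun _ _ => absRemainder_nonneg _ _

theorem convexOn_absRemainderSum (e : ι → ℝ) : ConvexOn ℝ Set.univ (absRemainderSum α e) := by
  have hsum : absRemainderSum α e
      = ∑ i, (fun t => absRemainder t (e i)) ∘ innerₛₗ ℝ (α i) := by
    ext u
    simp [absRemainderSum]
  rw [hsum]
  exact Finset.sum_induction _ (ConvexOn ℝ Set.univ) (fun _ _ => ConvexOn.add)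
    (convexOn_const 0 convex_univ) fun i _ => (convexOn_absRemainder (e i)).comp_linearMap _

theorem eventually_absRemainderSum_eq_zero {e : ι → ℝ} (he : ∀ i, e i ≠ 0) :
    ∀ᶠ u in 𝓝 (0 : E), absRemainderSum α e u = 0 := by
  have hsmall : ∀ i, ∀ᶠ u in 𝓝 (0 : E), |inner ℝ (α i) u| < |e i| := fun i =>
    ((by fun_prop : Continuous fun u : E => |inner ℝ (α i) u|).tendsto 0).eventually_lt_const
      (by simpa using he i)
  filter_upwards [eventually_all.2 hsmall] with u hu
  exact Finset.sum_eq_zero fun i _ => absRemainder_eq_zero (hu i)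

theorem neg_half_sum_abs_sub_eq (y : ι → ℝ) (u : E) :
    -(1 / 2) * ∑ i, |y i - inner ℝ (α i) u| - -(1 / 2) * ∑ i, |y i|
      = inner ℝ (absScore α y) u - absRemainderSum α y u := by
  rw [inner_absScore, absRemainderSum, Finset.mul_sum, Finset.mul_sum,
    ← Finset.sum_sub_distrib, ← Finset.sum_sub_distrib]
  refine Finset.sum_congr rfl fun i _ => ?_
  rw [absRemainder]
  ring

end Sums

section RandomResiduals

variable {E ι Ω : Type*} [NormedAddCommGroup E] [InnerProductSpace ℝ E] [Fintype ι]
  {α : ι → E} [MeasurableSpace Ω] {P : Measure Ω} {e : ι → Ω → ℝ} {δ ε R s x : ℝ}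

theorem measureReal_biUnion_le_half_exp {κ : Type*} {S : Finset κ} {B : κ → Set Ω} {m c : ℝ}
    (hS : (S.card : ℝ) ≤ Real.exp m) (hB : ∀ g ∈ S, P.real (B g) ≤ 2 * Real.exp (-c))
    (hc : x + 2 + m ≤ c) : P.real (⋃ g ∈ S, B g) ≤ Real.exp (-x) / 2 := by
  have hexp : Real.exp (-2) * 2 ≤ 1 / 2 := by
    have := Real.exp_neg_one_lt_d9
    rw [show (-2 : ℝ) = -1 + -1 by norm_num, Real.exp_add]
    nlinarith [Real.exp_pos (-1)]
  calc P.real (⋃ g ∈ S, B g) ≤ ∑ g ∈ S, P.real (B g) := measureReal_biUnion_finset_le _ _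
    _ ≤ ∑ _g ∈ S, 2 * Real.exp (-c) := Finset.sum_le_sum hB
    _ = S.card * (2 * Real.exp (-c)) := by rw [Finset.sum_const, nsmul_eq_mul]
    _ ≤ Real.exp m * (2 * Real.exp (-c)) := by gcongr
    _ = 2 * Real.exp (m - c) := by rw [sub_eq_add_neg, Real.exp_add]; ring
    _ ≤ 2 * Real.exp (-2 + -x) := by gcongr; linarith
    _ = Real.exp (-2) * 2 * Real.exp (-x) := by rw [Real.exp_add]; ring
    _ ≤ 1 / 2 * Real.exp (-x) := by gcongr
    _ = Real.exp (-x) / 2 := by ring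

variable [IsProbabilityMeasure P]

/-- The relative radius `ε` of a net of the ball of radius `256 * s * √q` produces a stochastic
error at most `expansionConst s * ε * q` in the quadratic approximation on this net. -/
def expansionConst (s : ℝ) : ℝ := 7 * 2 ^ 16 * s ^ 2 + 5

theorem integrable_sgn_comp {f : Ω → ℝ} (hf : Measurable f) : Integrable (fun ω => sgn (f ω)) P :=
  .of_bound (measurable_sgn.comp hf).aestronglyMeasurable 1 (.of_forall fun ω => (abs_sgn (f ω)).le)

theorem integrable_absScore (he : ∀ i, Measurable (e i)) :
    Integrable (fun ω => absScore α fun i => e i ω) P :=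
  (integrable_finsetSum _ fun i _ => (integrable_sgn_comp (he i)).smul_const (α i)).smul (1 / 2 : ℝ)

theorem integral_inner_absScore [CompleteSpace E] (he : ∀ i, Measurable (e i)) (u : E) :
    ∫ ω, inner ℝ (absScore α fun i => e i ω) u ∂P
      = inner ℝ (∫ ω, absScore α (fun i => e i ω) ∂P) u := by
  simp only [real_inner_comm u]
  exact integral_inner (integrable_absScore he) u

theorem integrable_absRemainder_comp {f : Ω → ℝ} (hf : Measurable f) (t : ℝ) :
    Integrable (fun ω => absRemainder t (f ω)) P :=
  .of_bound ((measurable_absRemainder t).comp hf).aestronglyMeasurable |t| (.of_forall fun ω => by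
    rw [Real.norm_of_nonneg (absRemainder_nonneg t _)]
    exact absRemainder_le_abs t _)

theorem integrable_absRemainderSum (he : ∀ i, Measurable (e i)) (u : E) :
    Integrable (fun ω => absRemainderSum α (fun i => e i ω) u) P :=
  integrable_finsetSum _ fun i _ => integrable_absRemainder_comp (he i) _

theorem integral_absRemainderSum (he : ∀ i, Measurable (e i)) (u : E) :
    ∫ ω, absRemainderSum α (fun i => e i ω) u ∂P
      = ∑ i, ∫ ω, absRemainder (inner ℝ (α i) u) (e i ω) ∂P :=
  integral_finsetSum _ fun i _ => integrable_absRemainder_comp (he i) _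

theorem abs_integral_absRemainderSum_sub_le {d : ι → ℝ → ℝ} {c : ι → ℝ} {ρ : ℝ}
    (he : ∀ i, Measurable (e i)) (hd : ∀ i, Measurable (d i)) (hd0 : ∀ i u, 0 ≤ d i u)
    (hlaw : ∀ i, P.map (e i) = volume.withDensity fun u => ENNReal.ofReal (d i u))
    (hdc : ∀ i u, |u| ≤ ρ → |d i u - c i| ≤ δ * c i) {u : E} (hu : ∀ i, |inner ℝ (α i) u| ≤ ρ) :
    |∫ ω, absRemainderSum α (fun i => e i ω) u ∂P - (∑ i, c i * inner ℝ (α i) u ^ 2) / 2|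
      ≤ δ / 2 * ∑ i, c i * inner ℝ (α i) u ^ 2 := by
  rw [integral_absRemainderSum he, Finset.sum_div, ← Finset.sum_sub_distrib, Finset.mul_sum]
  refine (Finset.abs_sum_le_sum_abs _ _).trans (Finset.sum_le_sum fun i _ => ?_)
  rw [← integral_map (he i).aemeasurable (measurable_absRemainder _).aestronglyMeasurable, hlaw i]
  exact (abs_integral_absRemainder_withDensity_sub_le (hd i) (hd0 i) (hdc i) (hu i)).trans_eq
    (by ring)

theorem eq_zero_of_inner_le_mul_sq_norm {v : E} {K r : ℝ} (hr : 0 < r)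
    (h : ∀ u, ‖u‖ ≤ r → inner ℝ v u ≤ K * ‖u‖ ^ 2) : v = 0 := by
  have hsmall : ∀ᶠ t in 𝓝[>] (0 : ℝ), ‖v‖ ^ 2 ≤ t * (K * ‖v‖ ^ 2) := by
    have hball : ∀ᶠ t in 𝓝[>] (0 : ℝ), ‖t • v‖ < r :=
      (((by fun_prop : Continuous fun t : ℝ => ‖t • v‖).tendsto 0).eventually_lt_const
        (by simpa using hr)).filter_mono nhdsWithin_le_nhds
    filter_upwards [hball, self_mem_nhdsWithin] with t ht ht0
    have ht' : 0 < t := ht0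
    have := h (t • v) ht.le
    rw [inner_smul_right, real_inner_self_eq_norm_sq, norm_smul, mul_pow, Real.norm_eq_abs,
      sq_abs] at this
    exact le_of_mul_le_mul_left (this.trans_eq (by ring)) ht'
  have hlim : Tendsto (fun t : ℝ => t * (K * ‖v‖ ^ 2)) (𝓝[>] 0) (𝓝 0) := by
    simpa using (tendsto_id.mul_const (K * ‖v‖ ^ 2)).mono_left (nhdsWithin_le_nhds (a := (0 : ℝ)))
  simpa using (sq_nonneg ‖v‖).antisymm' (ge_of_tendsto hlim hsmall)

/- The expected contrast is a linear function minus a nonnegative function of order `‖u‖ ^ 2`, so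
it has its maximum at `0` only if the linear part vanishes. -/
theorem integral_absScore_eq_zero [CompleteSpace E] (he : ∀ i, Measurable (e i)) (hR : 0 < R)
    (hmax : ∀ u, ∫ ω, (inner ℝ (absScore α fun i => e i ω) u
      - absRemainderSum α (fun i => e i ω) u) ∂P ≤ 0)
    (hmean : ∀ u, ‖u‖ ≤ R →
      |∫ ω, absRemainderSum α (fun i => e i ω) u ∂P - ‖u‖ ^ 2 / 2| ≤ δ / 2 * ‖u‖ ^ 2) :
    ∫ ω, absScore α (fun i => e i ω) ∂P = 0 := by
  refine eq_zero_of_inner_le_mul_sq_norm (K := (1 + δ) / 2) hR fun u hu => ?_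
  have hle := hmax u
  rw [integral_sub ((integrable_absScore he).inner_const u) (integrable_absRemainderSum he u),
    integral_inner_absScore he] at hle
  have := (abs_le.1 (hmean u hu)).2
  linarith

theorem sum_integral_sgn_mul_eq_inner [CompleteSpace E] (he : ∀ i, Measurable (e i)) (u : E) :
    ∑ i, ∫ ω, 1 / 2 * (sgn (e i ω) * inner ℝ (α i) u) ∂P
      = inner ℝ (∫ ω, absScore α (fun i => e i ω) ∂P) u := by
  rw [← integral_inner_absScore he]
  simp only [inner_absScore]
  exact (integral_finsetSum _ fun i _ =>
    ((integrable_sgn_comp (he i)).mul_const _).const_mul _).symm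

theorem measureReal_inner_absScore_ge_le [CompleteSpace E] (he : ∀ i, Measurable (e i))
    (hind : iIndepFun e P) (hmean : ∫ ω, absScore α (fun i => e i ω) ∂P = 0) {u : E} {v τ : ℝ}
    (hv : ∑ i, inner ℝ (α i) u ^ 2 ≤ 4 * v) (hτ : 0 ≤ τ) :
    P.real {ω | τ ≤ inner ℝ (absScore α fun i => e i ω) u} ≤ Real.exp (-τ ^ 2 / (2 * v)) := by
  have hX : ∀ i, Measurable fun y : ℝ => 1 / 2 * (sgn y * inner ℝ (α i) u) := fun i => by
    fun_prop
  have h := measureReal_sum_sub_mean_ge_le_of_sum_sq_le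
    (X := fun i ω => 1 / 2 * (sgn (e i ω) * inner ℝ (α i) u))
    (b := fun i => |inner ℝ (α i) u| / 2) (v := v) (fun i => (hX i).comp (he i))
    (hind.comp _ hX)
    (fun i ω => by
      rw [abs_mul, abs_mul, abs_sgn, abs_of_pos (by norm_num : (0 : ℝ) < 1 / 2)]
      linarith)
    (by
      simp only [div_pow, sq_abs, ← Finset.sum_div]
      linarith) hτ
  simpa only [sum_integral_sgn_mul_eq_inner he, hmean, inner_zero_left, sub_zero,
    ← inner_absScore] using h

theorem measureReal_lt_norm_absScore_le [FiniteDimensional ℝ E] [Nontrivial E]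
    (he : ∀ i, Measurable (e i)) (hind : iIndepFun e P)
    (hmean : ∫ ω, absScore α (fun i => e i ω) ∂P = 0) (hs : 0 < s)
    (hα : ∀ u, ∑ i, inner ℝ (α i) u ^ 2 ≤ (2 * s * ‖u‖) ^ 2) (hx : 0 < x) :
    P.real {ω | 8 * s * √(x + Module.finrank ℝ E) < ‖absScore α fun i => e i ω‖}
      ≤ Real.exp (-x) / 2 := by
  have := FiniteDimensional.complete ℝ E
  have hp : (1 : ℝ) ≤ Module.finrank ℝ E := by exact_mod_cast Module.finrank_pos (R := ℝ) (M := E)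
  set q := x + Module.finrank ℝ E
  obtain ⟨S, hS, hnet, hcard⟩ := exists_net_closedBall E zero_le_one (d := 1 / 2) (by norm_num)
  have hsub : {ω | 8 * s * √q < ‖absScore α fun i => e i ω‖}
      ⊆ ⋃ g ∈ S, {ω | 4 * s * √q ≤ inner ℝ (absScore α fun i => e i ω) g} := by
    intro ω hω
    by_contra hnot
    simp only [Set.mem_iUnion, Set.mem_ofPred_eq, not_exists, not_le] at hnot hω
    have hnorm := sub_mul_norm_le_of_net one_pos hnet
      (φ := innerSL ℝ (absScore α fun i => e i ω)) fun g hg => (hnot g hg).le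
    rw [innerSL_apply_norm] at hnorm
    linarith
  refine (measureReal_mono hsub (measure_ne_top P _)).trans
    (measureReal_biUnion_le_half_exp (c := 8 * q) hcard (fun g hg => ?_) ?_)
  · have hg1 : ‖g‖ ≤ 1 := by simpa using hS hg
    have hv : ∑ i, inner ℝ (α i) g ^ 2 ≤ 4 * s ^ 2 := (hα g).trans <| by
      rw [mul_pow, mul_pow]
      nlinarith [pow_le_one₀ (n := 2) (norm_nonneg g) hg1, sq_nonneg s]
    refine (measureReal_inner_absScore_ge_le he hind hmean hv (by positivity)).trans ?_
    have hexponent : -(4 * s * √q) ^ 2 / (2 * s ^ 2) = -(8 * q) := by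
      rw [mul_pow, Real.sq_sqrt (by positivity)]
      field_simp
      ring
    rw [hexponent]
    linarith [Real.exp_pos (-(8 * q))]
  · simp only [q]
    linarith

theorem measureReal_abs_absRemainderSum_sub_ge_le (he : ∀ i, Measurable (e i))
    (hind : iIndepFun e P) (hε : 0 < ε) (hε1 : ε ≤ 1) {u : E} {m : ℝ}
    (hα : ∀ i, |inner ℝ (α i) u| ≤ ε ^ 3)
    (hm : ∫ ω, absRemainderSum α (fun i => e i ω) u ∂P ≤ m) (τ : ℝ) :
    P.real {ω | τ ≤ |absRemainderSum α (fun i => e i ω) u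
      - ∫ ω', absRemainderSum α (fun i => e i ω') u ∂P|}
      ≤ 2 * Real.exp (-(τ / ε ^ 2) + m / ε) := by
  have hlc : (ε ^ 2)⁻¹ * ε ^ 3 ≤ 1 := by
    rwa [show (ε ^ 2)⁻¹ * ε ^ 3 = ε by field_simp]
  have hv : ∑ i, ∫ ω, absRemainder (inner ℝ (α i) u) (e i ω) ^ 2 ∂P ≤ ε ^ 3 * m := by
    refine le_trans ?_ (mul_le_mul_of_nonneg_left hm (by positivity))
    rw [integral_absRemainderSum he, Finset.mul_sum]
    refine Finset.sum_le_sum fun i _ => ?_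
    rw [← integral_const_mul]
    refine integral_mono_of_nonneg (.of_forall fun ω => sq_nonneg _)
      ((integrable_absRemainder_comp (he i) _).const_mul _) (.of_forall fun ω => ?_)
    simp only [sq]
    exact mul_le_mul_of_nonneg_right ((absRemainder_le_abs _ _).trans (hα i))
      (absRemainder_nonneg _ _)
  have h := measureReal_abs_sum_sub_mean_ge_le
    (X := fun i ω => absRemainder (inner ℝ (α i) u) (e i ω))
    (fun i => (measurable_absRemainder _).comp (he i))
    (hind.comp _ fun i => measurable_absRemainder _)
    (fun i ω => by
      rw [abs_of_nonneg (absRemainder_nonneg _ _)]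
      exact (absRemainder_le_abs _ _).trans (hα i))
    (by positivity) hlc hv τ
  rw [← integral_absRemainderSum he] at h
  refine h.trans_eq ?_
  congr 2
  field_simp

theorem measureReal_exists_abs_absRemainderSum_sub_le [FiniteDimensional ℝ E] [Nontrivial E]
    (he : ∀ i, Measurable (e i)) (hind : iIndepFun e P) (hx : 0 < x) (hR : 0 < R) (hε : 0 < ε)
    (hε16 : ε ≤ 1 / 16) (hδ0 : 0 ≤ δ) (hδ1 : δ ≤ 1) (hα : ∀ i, ‖α i‖ * R ≤ ε ^ 3)
    (hmean : ∀ u, ‖u‖ ≤ R →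
      |∫ ω, absRemainderSum α (fun i => e i ω) u ∂P - ‖u‖ ^ 2 / 2| ≤ δ / 2 * ‖u‖ ^ 2) :
    P.real {ω | ∃ u, ‖u‖ ≤ R / 4 ∧
      δ / 2 * ‖u‖ ^ 2 + ε * (7 * R ^ 2 + 5 * (x + Module.finrank ℝ E))
        < |absRemainderSum α (fun i => e i ω) u - ‖u‖ ^ 2 / 2|} ≤ Real.exp (-x) / 2 := by
  have hp : (1 : ℝ) ≤ Module.finrank ℝ E := by exact_mod_cast Module.finrank_pos (R := ℝ) (M := E)
  set p : ℝ := (Module.finrank ℝ E : ℝ)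
  set τ := ε * (R ^ 2 + 4 * (x + p)) with hτ
  obtain ⟨S, hS, hnet, hcard⟩ := exists_net_closedBall E hR.le (mul_pos hε hR)
  have hS' : ∀ g ∈ S, ‖g‖ ≤ R := fun g hg => by simpa using hS hg
  set B : E → Set Ω := fun g => {ω | τ ≤ |absRemainderSum α (fun i => e i ω) g
    - ∫ ω', absRemainderSum α (fun i => e i ω') g ∂P|}
  refine (measureReal_mono (s₂ := ⋃ g ∈ S, B g) (fun ω hω => ?_) (measure_ne_top P _)).trans
    (measureReal_biUnion_le_half_exp (c := 4 * (x + p) / ε) hcard (fun g hg => ?_) ?_)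
  · obtain ⟨u, hu, hlt⟩ := hω
    by_contra hnot
    simp only [B, Set.mem_iUnion, Set.mem_ofPred_eq, not_exists, not_le] at hnot
    have hle := abs_sub_half_sq_norm_le_of_net hR hε hε16 (by positivity : 0 ≤ τ) hδ0 hδ1 hS hnet
      (convexOn_absRemainderSum α fun i => e i ω) (absRemainderSum_nonneg α _)
      (fun g hg => by
        have := abs_sub_le (absRemainderSum α (fun i => e i ω) g)
          (∫ ω', absRemainderSum α (fun i => e i ω') g ∂P) (‖g‖ ^ 2 / 2)
        linarith [hnot g hg, hmean g (hS' g hg)]) hu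
    nlinarith [mul_nonneg hε.le (sq_nonneg R),
      mul_nonneg hε.le (add_pos hx (by linarith : 0 < p)).le]
  · have hsq : ‖g‖ ^ 2 ≤ R ^ 2 := pow_le_pow_left₀ (norm_nonneg g) (hS' g hg) 2
    refine (measureReal_abs_absRemainderSum_sub_ge_le he hind hε (by linarith) (m := R ^ 2)
      (fun i => (abs_real_inner_le_norm _ _).trans
        ((mul_le_mul_of_nonneg_left (hS' g hg) (norm_nonneg _)).trans (hα i)))
      (by nlinarith [(abs_le.1 (hmean g (hS' g hg))).2, sq_nonneg ‖g‖]) τ).trans_eq ?_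
    congr 2
    rw [hτ]
    field_simp
    ring
  · rw [mul_div_mul_right _ _ hR.ne', le_div_iff₀ hε]
    field_simp
    nlinarith

theorem measureReal_not_fisherWilksExpansion_le [FiniteDimensional ℝ E] [Nontrivial E]
    (he : ∀ i, Measurable (e i)) (hind : iIndepFun e P) (hx : 0 < x) (hs : 0 < s)
    (hR : R = 256 * s * √(x + Module.finrank ℝ E)) (hε : 0 < ε) (hε16 : ε ≤ 1 / 16)
    (hεs : ε * expansionConst s ≤ 256 * s ^ 2) (hδ0 : 0 ≤ δ) (hδ2 : δ ≤ 1 / 2)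
    (hα : ∀ i, ‖α i‖ * R ≤ ε ^ 3) (hα2 : ∀ u, ∑ i, inner ℝ (α i) u ^ 2 ≤ (2 * s * ‖u‖) ^ 2)
    (hmax : ∀ u, ∫ ω, (inner ℝ (absScore α fun i => e i ω) u
      - absRemainderSum α (fun i => e i ω) u) ∂P ≤ 0)
    (hmean : ∀ u, ‖u‖ ≤ R →
      |∫ ω, absRemainderSum α (fun i => e i ω) u ∂P - ‖u‖ ^ 2 / 2| ≤ δ / 2 * ‖u‖ ^ 2) :
    P.real {ω | ¬ FisherWilksExpansion (absScore α fun i => e i ω)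
      (absRemainderSum α fun i => e i ω)
      ((2 ^ 13 * s ^ 2 * δ + 4 * expansionConst s * ε) * (x + Module.finrank ℝ E))}
      ≤ Real.exp (-x) := by
  have := FiniteDimensional.complete ℝ E
  set q := x + Module.finrank ℝ E
  have hq : 0 < q := by positivity
  have hR0 : 0 < R := by rw [hR]; positivity
  have hR2 : R ^ 2 = 2 ^ 16 * s ^ 2 * q := by
    rw [hR, mul_pow, Real.sq_sqrt hq.le]
    ring
  have hscore := measureReal_lt_norm_absScore_le he hind
    (integral_absScore_eq_zero he hR0 hmax hmean) hs hα2 hx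
  have hrem := measureReal_exists_abs_absRemainderSum_sub_le he hind hx hR0 hε hε16 hδ0
    (by linarith) hα hmean
  refine (measureReal_mono (fun ω hω => ?_) (measure_ne_top P _)).trans
    ((measureReal_union_le _ _).trans ((add_le_add hscore hrem).trans_eq (add_halves _)))
  by_contra hgood
  simp only [Set.mem_union, Set.mem_ofPred_eq, not_or, not_exists, not_and, not_lt] at hgood
  refine hω ?_
  convert fisherWilksExpansion_of_abs_sub_half_sq_norm_le (convexOn_absRemainderSum α _)
    (absRemainderSum_zero α _) (by positivity) hδ0 hδ2 hgood.2 (hgood.1.trans_eq ?_) ?_ using 1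
  · rw [div_pow, hR2, expansionConst]
    ring
  · rw [hR]
    ring
  · rw [div_pow, hR2]
    unfold expansionConst at hεs
    nlinarith

theorem exists_measurableSet_of_ae {Q B : Ω → Prop} {r : ℝ} (hB : P.real {ω | ¬ B ω} ≤ r)
    (hQ : ∀ᵐ ω ∂P, B ω → Q ω) :
    ∃ A : Set Ω, MeasurableSet A ∧ 1 - r ≤ P.real A ∧ ∀ ω ∈ A, Q ω := by
  have hle : P.real {ω | ¬ Q ω} ≤ P.real {ω | ¬ B ω} :=
    ENNReal.toReal_mono (measure_ne_top P _)
      (measure_mono_ae (hQ.mono fun ω hω hnQ hBω => hnQ (hω hBω)))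
  refine ⟨(toMeasurable P {ω | ¬ Q ω})ᶜ, (measurableSet_toMeasurable _ _).compl, ?_,
    fun ω hω => not_not.1 fun hnQ => hω (subset_toMeasurable _ _ hnQ)⟩
  rw [probReal_compl_eq_one_sub (measurableSet_toMeasurable _ _), measureReal_def,
    measure_toMeasurable, ← measureReal_def]
  linarith

end RandomResiduals

section Matrices

variable {n p : ℕ} {Ψ : Fin n → EuclideanSpace ℝ (Fin p)} {dens : Fin n → ℝ → ℝ}

theorem act_mul (M N : Matrix (Fin p) (Fin p) ℝ) (v : EuclideanSpace ℝ (Fin p)) :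
    act M (act N v) = act (M * N) v := by
  simp [act, Matrix.mulVec_mulVec]

theorem act_one (v : EuclideanSpace ℝ (Fin p)) : act 1 v = v := by
  simp [act]

theorem act_eq_toEuclideanLin (M : Matrix (Fin p) (Fin p) ℝ) : act M = Matrix.toEuclideanLin M :=
  rfl

theorem inner_act {M : Matrix (Fin p) (Fin p) ℝ} (hM : M.transpose = M)
    (u v : EuclideanSpace ℝ (Fin p)) : inner ℝ (act M u) v = inner ℝ u (act M v) := by
  simp only [EuclideanSpace.inner_eq_star_dotProduct, act, star_trivial]
  rw [Matrix.dotProduct_mulVec, ← Matrix.mulVec_transpose, hM]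

theorem inner_act_sum_vecMulVec (c : Fin n → ℝ) (Ψ : Fin n → EuclideanSpace ℝ (Fin p))
    (u : EuclideanSpace ℝ (Fin p)) :
    inner ℝ u (act (∑ i, c i • Matrix.vecMulVec (Ψ i).ofLp (Ψ i).ofLp) u)
      = ∑ i, c i * inner ℝ (Ψ i) u ^ 2 := by
  simp only [EuclideanSpace.inner_eq_star_dotProduct, act, star_trivial, Matrix.sum_mulVec,
    sum_dotProduct, Matrix.smul_mulVec, Matrix.vecMulVec_mulVec, smul_dotProduct]
  refine Finset.sum_congr rfl fun i _ => ?_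
  rw [dotProduct_comm u.ofLp]
  simp only [op_smul_eq_smul, smul_eq_mul]
  ring

theorem posSqrt_transpose (M : Matrix (Fin p) (Fin p) ℝ) : (posSqrt M).transpose = posSqrt M := by
  simpa [Matrix.IsHermitian] using (posSqrt_posSemidef M).isHermitian

theorem sq_norm_act_posSqrt {M : Matrix (Fin p) (Fin p) ℝ} (hM : M.PosSemidef)
    (u : EuclideanSpace ℝ (Fin p)) : ‖act (posSqrt M) u‖ ^ 2 = inner ℝ u (act M u) := by
  rw [← real_inner_self_eq_norm_sq, inner_act (posSqrt_transpose M), act_mul, posSqrt_mul_self hM]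

theorem isUnit_det_posSqrt {M : Matrix (Fin p) (Fin p) ℝ} (hM : M.PosDef) :
    IsUnit (posSqrt M).det := by
  have hdet := hM.det_pos
  rw [← posSqrt_mul_self hM.posSemidef, Matrix.det_mul] at hdet
  exact isUnit_iff_ne_zero.2 (left_ne_zero_of_mul hdet.ne')

theorem V0sq_eq_sum (Ψ : Fin n → EuclideanSpace ℝ (Fin p)) :
    V0sq Ψ = ∑ i, (1 / 4 : ℝ) • Matrix.vecMulVec (Ψ i).ofLp (Ψ i).ofLp := by
  rw [V0sq, Finset.smul_sum]

theorem sq_norm_act_V0 (hV : (V0sq Ψ).PosDef) (u : EuclideanSpace ℝ (Fin p)) :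
    ‖act (V0 Ψ) u‖ ^ 2 = 1 / 4 * ∑ i, inner ℝ (Ψ i) u ^ 2 := by
  rw [V0, sq_norm_act_posSqrt hV.posSemidef, V0sq_eq_sum, inner_act_sum_vecMulVec, Finset.mul_sum]

theorem posDef_D0sq (hV : (V0sq Ψ).PosDef) (hpos : ∀ i, 0 < dens i 0) :
    (D0sq Ψ dens).PosDef := by
  refine Matrix.PosDef.of_dotProduct_mulVec_pos ?_ fun x hx => ?_
  · simp [Matrix.IsHermitian, D0sq, Matrix.transpose_sum, Matrix.transpose_vecMulVec]
  · have hform : ∀ M : Matrix (Fin p) (Fin p) ℝ, star x ⬝ᵥ M.mulVec x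
        = inner ℝ (WithLp.toLp 2 x) (act M (WithLp.toLp 2 x)) := fun M => by
      simp [EuclideanSpace.inner_eq_star_dotProduct, act, dotProduct_comm]
    have hVx := hV.dotProduct_mulVec_pos hx
    rw [hform, V0sq_eq_sum, inner_act_sum_vecMulVec] at hVx
    rw [hform, D0sq, inner_act_sum_vecMulVec]
    obtain ⟨i, -, hi⟩ := Finset.exists_lt_of_sum_lt (by simpa using hVx :
      ∑ _i : Fin n, (0 : ℝ) < _)
    exact Finset.sum_pos' (fun i _ => mul_nonneg (hpos i).le (sq_nonneg _))
      ⟨i, Finset.mem_univ i, mul_pos (hpos i) (by linarith)⟩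

/-- The quantity `N^{-1/2}`, whose inverse square is the effective sample size `N`. -/
def leverage (Ψ : Fin n → EuclideanSpace ℝ (Fin p)) : ℝ :=
  ⨆ i, ⨆ γ : EuclideanSpace ℝ (Fin p), inner ℝ (Ψ i) γ / (2 * ‖act (V0 Ψ) γ‖)

theorem abs_inner_le_two_mul_norm_act_V0 (hV : (V0sq Ψ).PosDef) (i : Fin n)
    (γ : EuclideanSpace ℝ (Fin p)) : |inner ℝ (Ψ i) γ| ≤ 2 * ‖act (V0 Ψ) γ‖ := by
  refine abs_le_of_sq_le_sq ?_ (by positivity)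
  rw [mul_pow, sq_norm_act_V0 hV]
  have := Finset.single_le_sum (f := fun i => inner ℝ (Ψ i) γ ^ 2) (fun i _ => sq_nonneg _)
    (Finset.mem_univ i)
  linarith

theorem inner_div_le_leverage (hV : (V0sq Ψ).PosDef) (i : Fin n)
    (γ : EuclideanSpace ℝ (Fin p)) :
    inner ℝ (Ψ i) γ / (2 * ‖act (V0 Ψ) γ‖) ≤ leverage Ψ := by
  have hbdd : BddAbove (Set.range fun γ => inner ℝ (Ψ i) γ / (2 * ‖act (V0 Ψ) γ‖)) := by
    refine ⟨1, ?_⟩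
    rintro _ ⟨γ, rfl⟩
    exact div_le_one_of_le₀ ((le_abs_self _).trans (abs_inner_le_two_mul_norm_act_V0 hV i γ))
      (by positivity)
  exact (le_ciSup hbdd γ).trans (le_ciSup
    (f := fun i => ⨆ γ, inner ℝ (Ψ i) γ / (2 * ‖act (V0 Ψ) γ‖)) (Set.finite_range _).bddAbove i)

theorem abs_inner_le_leverage (hV : (V0sq Ψ).PosDef) (i : Fin n)
    (γ : EuclideanSpace ℝ (Fin p)) :
    |inner ℝ (Ψ i) γ| ≤ leverage Ψ * (2 * ‖act (V0 Ψ) γ‖) := by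
  rcases (norm_nonneg (act (V0 Ψ) γ)).eq_or_lt with h0 | h0
  · simpa [← h0] using abs_inner_le_two_mul_norm_act_V0 hV i γ
  · have hneg := inner_div_le_leverage hV i (-γ)
    rw [act_eq_toEuclideanLin, map_neg, norm_neg, inner_neg_right, ← act_eq_toEuclideanLin,
      div_le_iff₀ (by positivity)] at hneg
    exact abs_le'.2 ⟨(div_le_iff₀ (by positivity)).1 (inner_div_le_leverage hV i γ), hneg⟩

theorem leverage_eq_inv_sqrt_effN (hV : (V0sq Ψ).PosDef) (i : Fin n) :
    leverage Ψ = (√(effN Ψ))⁻¹ := by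
  have hnonneg : 0 ≤ leverage Ψ := by simpa using inner_div_le_leverage hV i 0
  rw [show effN Ψ = (leverage Ψ ^ 2)⁻¹ from rfl, Real.sqrt_inv, inv_inv, Real.sqrt_sq hnonneg]

end Matrices

section Coordinates

variable {n p : ℕ} {Ψ : Fin n → EuclideanSpace ℝ (Fin p)} {dens : Fin n → ℝ → ℝ} {a : ℝ}

/-- The features `D₀⁻¹ Ψᵢ` in the coordinates `u = D₀ (θ - θ*)`, in which the information matrix
is the identity. -/
def normFeature (Ψ : Fin n → EuclideanSpace ℝ (Fin p)) (dens : Fin n → ℝ → ℝ) (i : Fin n) :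
    EuclideanSpace ℝ (Fin p) :=
  act (D0 Ψ dens)⁻¹ (Ψ i)

theorem inner_normFeature (i : Fin n) (u : EuclideanSpace ℝ (Fin p)) :
    inner ℝ (normFeature Ψ dens i) u = inner ℝ (Ψ i) (act (D0 Ψ dens)⁻¹ u) :=
  inner_act (by rw [Matrix.transpose_nonsing_inv, D0, posSqrt_transpose]) _ _

theorem act_D0_act_inv_D0 (hD : (D0sq Ψ dens).PosDef) (u : EuclideanSpace ℝ (Fin p)) :
    act (D0 Ψ dens) (act (D0 Ψ dens)⁻¹ u) = u := by
  rw [act_mul, D0, Matrix.mul_nonsing_inv _ (isUnit_det_posSqrt hD), act_one]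

theorem act_inv_D0_act_D0 (hD : (D0sq Ψ dens).PosDef) (u : EuclideanSpace ℝ (Fin p)) :
    act (D0 Ψ dens)⁻¹ (act (D0 Ψ dens) u) = u := by
  rw [act_mul, D0, Matrix.nonsing_inv_mul _ (isUnit_det_posSqrt hD), act_one]

theorem sum_dens_mul_sq_inner_normFeature (hD : (D0sq Ψ dens).PosDef)
    (u : EuclideanSpace ℝ (Fin p)) :
    ∑ i, dens i 0 * inner ℝ (normFeature Ψ dens i) u ^ 2 = ‖u‖ ^ 2 := by
  simp only [inner_normFeature]
  rw [← inner_act_sum_vecMulVec, ← D0sq, ← sq_norm_act_posSqrt hD.posSemidef, ← D0,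
    act_D0_act_inv_D0 hD]

theorem sum_sq_inner_normFeature_le (ha : 0 < a) (hD : (D0sq Ψ dens).PosDef)
    (hda : ∀ i, a ^ 2 / 4 ≤ dens i 0) (u : EuclideanSpace ℝ (Fin p)) :
    ∑ i, inner ℝ (normFeature Ψ dens i) u ^ 2 ≤ (2 * a⁻¹ * ‖u‖) ^ 2 := by
  rw [show (2 * a⁻¹ * ‖u‖) ^ 2 = 4 * ‖u‖ ^ 2 / a ^ 2 by field_simp; ring,
    le_div_iff₀ (by positivity), ← sum_dens_mul_sq_inner_normFeature hD u, Finset.sum_mul,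
    Finset.mul_sum]
  refine Finset.sum_le_sum fun i _ => ?_
  nlinarith [hda i, sq_nonneg (inner ℝ (normFeature Ψ dens i) u)]

theorem norm_act_V0_act_inv_D0_le (ha : 0 < a) (hV : (V0sq Ψ).PosDef)
    (hD : (D0sq Ψ dens).PosDef) (hda : ∀ i, a ^ 2 / 4 ≤ dens i 0)
    (u : EuclideanSpace ℝ (Fin p)) :
    ‖act (V0 Ψ) (act (D0 Ψ dens)⁻¹ u)‖ ≤ a⁻¹ * ‖u‖ := by
  refine le_of_sq_le_sq ?_ (by positivity)
  have := sum_sq_inner_normFeature_le ha hD hda u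
  simp only [inner_normFeature, mul_assoc] at this
  rw [sq_norm_act_V0 hV]
  linarith

theorem norm_normFeature_le (ha : 0 < a) (hV : (V0sq Ψ).PosDef) (hD : (D0sq Ψ dens).PosDef)
    (hda : ∀ i, a ^ 2 / 4 ≤ dens i 0) (i : Fin n) :
    ‖normFeature Ψ dens i‖ ≤ 2 / (a * √(effN Ψ)) := by
  have hlev : 0 ≤ leverage Ψ := by
    rw [leverage_eq_inv_sqrt_effN hV i]
    positivity
  have hinner : ∀ u, ‖innerSL ℝ (normFeature Ψ dens i) u‖ ≤ 2 * a⁻¹ * leverage Ψ * ‖u‖ := by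
    intro u
    calc |inner ℝ (normFeature Ψ dens i) u|
        ≤ leverage Ψ * (2 * ‖act (V0 Ψ) (act (D0 Ψ dens)⁻¹ u)‖) := by
          rw [inner_normFeature]
          exact abs_inner_le_leverage hV i _
      _ ≤ leverage Ψ * (2 * (a⁻¹ * ‖u‖)) := by
          gcongr
          exact norm_act_V0_act_inv_D0_le ha hV hD hda u
      _ = 2 * a⁻¹ * leverage Ψ * ‖u‖ := by ring
  have hnorm := ContinuousLinearMap.opNorm_le_bound _ (by positivity) hinner
  rw [innerSL_apply_norm, leverage_eq_inv_sqrt_effN hV i] at hnorm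
  exact hnorm.trans_eq (by field_simp)

theorem logLik_sub_eq (y : Fin n → ℝ) (θ θs : EuclideanSpace ℝ (Fin p)) :
    logLik Ψ y θ - logLik Ψ y θs
      = inner ℝ (absScore Ψ fun i => y i - inner ℝ (Ψ i) θs) (θ - θs)
        - absRemainderSum Ψ (fun i => y i - inner ℝ (Ψ i) θs) (θ - θs) := by
  rw [← neg_half_sum_abs_sub_eq, logLik, logLik]
  simp only [inner_sub_right, sub_sub, add_sub_cancel]

theorem gradient_logLik (y : Fin n → ℝ) (θs : EuclideanSpace ℝ (Fin p))
    (hy : ∀ i, y i - inner ℝ (Ψ i) θs ≠ 0) :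
    gradient (logLik Ψ y) θs = absScore Ψ fun i => y i - inner ℝ (Ψ i) θs := by
  set S := absScore Ψ fun i => y i - inner ℝ (Ψ i) θs
  have haffine : logLik Ψ y =ᶠ[𝓝 θs] fun θ =>
      InnerProductSpace.toDual ℝ _ S θ + (logLik Ψ y θs - inner ℝ S θs) := by
    have hsub : Tendsto (fun θ => θ - θs) (𝓝 θs) (𝓝 0) := by
      simpa using (continuous_sub_right θs).tendsto θs
    filter_upwards [hsub.eventually (eventually_absRemainderSum_eq_zero Ψ hy)] with θ hθ
    have := logLik_sub_eq (Ψ := Ψ) y θ θs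
    rw [hθ, sub_zero, inner_sub_right] at this
    rw [InnerProductSpace.toDual_apply_apply]
    linarith
  exact (hasGradientAt_iff_hasFDerivAt.2 (((InnerProductSpace.toDual ℝ _ S).hasFDerivAt.add_const
    _).congr_of_eventuallyEq haffine)).gradient

theorem inner_absScore_normFeature_sub (y : Fin n → ℝ) (θs u : EuclideanSpace ℝ (Fin p)) :
    inner ℝ (absScore (normFeature Ψ dens) fun i => y i - inner ℝ (Ψ i) θs) u
        - absRemainderSum (normFeature Ψ dens) (fun i => y i - inner ℝ (Ψ i) θs) u
      = logLik Ψ y (θs + act (D0 Ψ dens)⁻¹ u) - logLik Ψ y θs := by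
  rw [logLik_sub_eq, add_sub_cancel_left, inner_absScore, inner_absScore, absRemainderSum,
    absRemainderSum]
  simp only [inner_normFeature]

theorem score_eq_absScore_normFeature (y : Fin n → ℝ) (θs : EuclideanSpace ℝ (Fin p))
    (hy : ∀ i, y i - inner ℝ (Ψ i) θs ≠ 0) :
    score Ψ dens θs y
      = absScore (normFeature Ψ dens) fun i => y i - inner ℝ (Ψ i) θs := by
  rw [score, gradient_logLik y θs hy, act_eq_toEuclideanLin, absScore, map_smul, map_sum]
  simp only [map_smul, ← act_eq_toEuclideanLin]
  rfl

theorem expansion_of_fisherWilksExpansion {B : ℝ} (hD : (D0sq Ψ dens).PosDef) {y : Fin n → ℝ}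
    {θs θt : EuclideanSpace ℝ (Fin p)} (hy : ∀ i, y i - inner ℝ (Ψ i) θs ≠ 0)
    (hexp : FisherWilksExpansion (absScore (normFeature Ψ dens) fun i => y i - inner ℝ (Ψ i) θs)
      (absRemainderSum (normFeature Ψ dens) fun i => y i - inner ℝ (Ψ i) θs) B)
    (hθt : IsMaxOn (logLik Ψ y) Set.univ θt) :
    ‖act (D0 Ψ dens) (θt - θs) - score Ψ dens θs y‖ ^ 2 ≤ B ∧
      |2 * (logLik Ψ y θt - logLik Ψ y θs) - ‖score Ψ dens θs y‖ ^ 2| ≤ B := by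
  have hθ : θs + act (D0 Ψ dens)⁻¹ (act (D0 Ψ dens) (θt - θs)) = θt := by
    rw [act_inv_D0_act_D0 hD, add_sub_cancel]
  have hmax := hexp (act (D0 Ψ dens) (θt - θs)) fun u _ => by
    simp only [Set.mem_ofPred_eq, inner_absScore_normFeature_sub, hθ]
    exact sub_le_sub_right (hθt (Set.mem_univ _)) _
  rwa [inner_absScore_normFeature_sub, hθ, ← score_eq_absScore_normFeature y θs hy] at hmax

end Coordinates

section NetScale

variable {a t ε₀ : ℝ}

/-- The relative radius of the net in the concentration argument at the ratio `t = N / (x + p)`: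
its cube bounds the shifts `|Ψᵢᵀ (θ - θ*)|` of the residuals over the localization ball, and it
is the order of the resulting error. -/
def netScale (a t : ℝ) : ℝ := (512 / (a ^ 2 * √t)) ^ (3⁻¹ : ℝ)

theorem netScale_pow_three (a t : ℝ) : netScale a t ^ 3 = 512 / (a ^ 2 * √t) := by
  exact_mod_cast Real.rpow_inv_natCast_pow (n := 3) (by positivity : 0 ≤ 512 / (a ^ 2 * √t))
    three_ne_zero

theorem netScale_pos (ha : 0 < a) (ht : 0 < t) : 0 < netScale a t :=
  Real.rpow_pos_of_pos (by positivity) _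

theorem tendsto_netScale (ha : 0 < a) : Tendsto (netScale a) atTop (𝓝 0) := by
  have hbase : Tendsto (fun t => 512 / (a ^ 2 * √t)) atTop (𝓝 0) :=
    (Real.tendsto_sqrt_atTop.const_mul_atTop (by positivity)).const_div_atTop 512
  have hpow := hbase.rpow_const (p := (3⁻¹ : ℝ)) (Or.inr (by norm_num))
  rwa [Real.zero_rpow (by norm_num)] at hpow

theorem exists_forall_netScale_le (ha : 0 < a) (hε₀ : 0 < ε₀) :
    ∃ C₂ > 0, ∀ ρ t : ℝ, 0 < ρ → ρ * a ^ 2 ≤ 4 → C₂ * ρ⁻¹ ^ 2 * a ^ 2 ≤ t →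
      netScale a t ^ 3 ≤ ρ ∧ netScale a t ≤ ε₀ := by
  set η := min 1 (a ^ 2 * ε₀ ^ 3 / 4)
  have hη : 0 < η := by positivity
  refine ⟨2 ^ 18 / (a ^ 6 * η ^ 2), by positivity, fun ρ t hρ hρa ht => ?_⟩
  have hsqrt : 512 / (a ^ 2 * (η * ρ)) ≤ √t := by
    refine Real.le_sqrt_of_sq_le (le_of_eq_of_le ?_ ht)
    field_simp
    norm_num
  have hcube : netScale a t ^ 3 ≤ η * ρ := by
    have hsqrt0 : 0 < √t := lt_of_lt_of_le (by positivity) hsqrt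
    rw [netScale_pow_three, div_le_iff₀ (by positivity)]
    rw [div_le_iff₀ (by positivity)] at hsqrt
    exact hsqrt.trans_eq (by ring)
  have hη₀ : η * ρ ≤ ε₀ ^ 3 :=
    calc η * ρ ≤ a ^ 2 * ε₀ ^ 3 / 4 * ρ := by
          gcongr
          exact min_le_right _ _
      _ = ρ * a ^ 2 / 4 * ε₀ ^ 3 := by ring
      _ ≤ 1 * ε₀ ^ 3 := by
          gcongr
          linarith
      _ = ε₀ ^ 3 := one_mul _
  exact ⟨hcube.trans (mul_le_of_le_one_left hρ.le (min_le_left _ _)),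
    le_of_pow_le_pow_left₀ three_ne_zero hε₀.le (hcube.trans hη₀)⟩

end NetScale

section ResidualDensity

variable {Ω : Type*} [MeasurableSpace Ω] {P : Measure Ω}

theorem abs_sub_le_mul_of_abs_div_sub_one_le {y c δ : ℝ} (hc : 0 < c) (h : |y / c - 1| ≤ δ) :
    |y - c| ≤ δ * c := by
  rwa [div_sub_one hc.ne', abs_div, abs_of_pos hc, div_le_iff₀ hc] at h

theorem mul_le_four_of_abs_div_sub_one_le [IsProbabilityMeasure P] {e : Ω → ℝ} {d : ℝ → ℝ}
    {c ρ δ : ℝ} (he : Measurable e)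
    (hlaw : P.map e = volume.withDensity fun u => ENNReal.ofReal (d u)) (hc : 0 < c)
    (hcd : c / 4 ≤ d 0) (hδ2 : δ ≤ 1 / 2) (hδ : ∀ u, |u| ≤ ρ → |d u / d 0 - 1| ≤ δ) :
    ρ * c ≤ 4 := by
  have : IsProbabilityMeasure (volume.withDensity fun u => ENNReal.ofReal (d u)) :=
    hlaw ▸ Measure.isProbabilityMeasure_map he.aemeasurable
  have hd0 : 0 < d 0 := by linarith
  have hmass := two_mul_mul_le_one_of_le_density (ρ := ρ) (c := c / 8) (by positivity)
    fun u hu => ENNReal.ofReal_le_ofReal <| show c / 8 ≤ d u by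
      have := abs_le.1 (abs_sub_le_mul_of_abs_div_sub_one_le hd0 (hδ u hu))
      nlinarith
  linarith

theorem ae_forall_ne_zero_of_map_eq_withDensity {ι : Type*} [Countable ι] {e : ι → Ω → ℝ}
    {f : ι → ℝ → ENNReal} (he : ∀ i, Measurable (e i))
    (hlaw : ∀ i, P.map (e i) = volume.withDensity (f i)) : ∀ᵐ ω ∂P, ∀ i, e i ω ≠ 0 := by
  refine ae_all_iff.2 fun i => ae_of_ae_map (p := (· ≠ 0)) (he i).aemeasurable ?_
  rw [hlaw i]
  exact (withDensity_absolutelyContinuous _ _).ae_le (Measure.ae_ne volume 0)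

end ResidualDensity

section LeastAbsoluteDeviations

variable {n p : ℕ} {Ψ : Fin n → EuclideanSpace ℝ (Fin p)} {dens : Fin n → ℝ → ℝ} {a : ℝ}

theorem nonempty_of_effN_pos (hN : 0 < effN Ψ) : Nonempty (Fin n) := by
  by_contra hn
  rw [not_nonempty_iff] at hn
  simp [effN] at hN

theorem norm_normFeature_mul_le (ha : 0 < a) (hV : (V0sq Ψ).PosDef) (hD : (D0sq Ψ dens).PosDef)
    (hda : ∀ i, a ^ 2 / 4 ≤ dens i 0) {q : ℝ} (hq : 0 < q) (i : Fin n) :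
    ‖normFeature Ψ dens i‖ * (256 * a⁻¹ * √q) ≤ netScale a (effN Ψ / q) ^ 3 := by
  rw [netScale_pow_three, Real.sqrt_div' _ hq.le]
  refine (mul_le_mul_of_nonneg_right (norm_normFeature_le ha hV hD hda i)
    (by positivity)).trans_eq ?_
  field_simp
  norm_num

variable {Ω : Type*} [MeasurableSpace Ω] {P : Measure Ω} [IsProbabilityMeasure P]
  {Y : Fin n → Ω → ℝ} {θs : EuclideanSpace ℝ (Fin p)} {ρ δ x : ℝ}

theorem measureReal_not_fisherWilksExpansion_normFeature_le (ha : 0 < a) (hp : 0 < p)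
    (hV : (V0sq Ψ).PosDef) (hY : ∀ i, Measurable (Y i)) (hind : iIndepFun Y P)
    (hmax : ∀ θ, ∫ ω, (logLik Ψ (fun i => Y i ω) θ - logLik Ψ (fun i => Y i ω) θs) ∂P ≤ 0)
    (hd : ∀ i, Measurable (dens i)) (hd0 : ∀ i u, 0 ≤ dens i u)
    (hlaw : ∀ i, P.map (fun ω => Y i ω - inner ℝ (Ψ i) θs) =
      volume.withDensity (fun u => ENNReal.ofReal (dens i u)))
    (hda : ∀ i, a ^ 2 / 4 ≤ dens i 0) (hδ0 : 0 ≤ δ) (hδ2 : δ ≤ 1 / 2)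
    (hδ : ∀ i u, |u| ≤ ρ → |dens i u / dens i 0 - 1| ≤ δ) (hx : 0 < x) (hN : 0 < effN Ψ)
    (hερ : netScale a (effN Ψ / (x + p)) ^ 3 ≤ ρ)
    (hε16 : netScale a (effN Ψ / (x + p)) ≤ 1 / 16)
    (hεa : netScale a (effN Ψ / (x + p)) * expansionConst a⁻¹ ≤ 256 * a⁻¹ ^ 2) :
    P.real {ω | ¬ FisherWilksExpansion
      (absScore (normFeature Ψ dens) fun i => Y i ω - inner ℝ (Ψ i) θs)
      (absRemainderSum (normFeature Ψ dens) fun i => Y i ω - inner ℝ (Ψ i) θs)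
      ((2 ^ 13 * a⁻¹ ^ 2 * δ + 4 * expansionConst a⁻¹ * netScale a (effN Ψ / (x + p)))
        * (x + p))} ≤ Real.exp (-x) := by
  have hpos : ∀ i, 0 < dens i 0 := fun i => lt_of_lt_of_le (by positivity) (hda i)
  have hD := posDef_D0sq hV hpos
  have hq : 0 < x + (p : ℝ) := by positivity
  have he : ∀ i, Measurable fun ω => Y i ω - inner ℝ (Ψ i) θs := fun i => (hY i).sub_const _
  have hradius := norm_normFeature_mul_le ha hV hD hda hq
  have hmean : ∀ u, ‖u‖ ≤ 256 * a⁻¹ * √(x + p) →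
      |∫ ω, absRemainderSum (normFeature Ψ dens) (fun i => Y i ω - inner ℝ (Ψ i) θs) u ∂P
        - ‖u‖ ^ 2 / 2| ≤ δ / 2 * ‖u‖ ^ 2 := by
    intro u hu
    rw [← sum_dens_mul_sq_inner_normFeature hD u]
    refine abs_integral_absRemainderSum_sub_le he hd hd0 hlaw
      (fun i v hv => abs_sub_le_mul_of_abs_div_sub_one_le (hpos i) (hδ i v hv)) fun i => ?_
    calc |inner ℝ (normFeature Ψ dens i) u| ≤ ‖normFeature Ψ dens i‖ * ‖u‖ :=
          abs_real_inner_le_norm _ _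
      _ ≤ ‖normFeature Ψ dens i‖ * (256 * a⁻¹ * √(x + p)) := by gcongr
      _ ≤ ρ := (hradius i).trans hερ
  have : Nonempty (Fin p) := ⟨⟨0, hp⟩⟩
  have hbound := measureReal_not_fisherWilksExpansion_le (α := normFeature Ψ dens) (s := a⁻¹)
    (δ := δ) he (hind.comp (fun i y => y - inner ℝ (Ψ i) θs) fun i => measurable_id.sub_const _)
    hx (inv_pos.2 ha) rfl (netScale_pos ha (div_pos hN hq)) hε16 hεa hδ0 hδ2
  simp only [finrank_euclideanSpace_fin, inner_absScore_normFeature_sub] at hbound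
  exact hbound hradius (sum_sq_inner_normFeature_le ha hD hda) (fun u => hmax _) hmean

end LeastAbsoluteDeviations

end

end LAD

theorem mainTheorem12_general (a : ℝ) (ha : 0 < a) :
    ∃ (C₂ K : ℝ) (κ : ℝ → ℝ), 0 < C₂ ∧ 0 < K ∧ Tendsto κ atTop (𝓝 0) ∧
      ∀ (n p : ℕ) (Ψ : Fin n → EuclideanSpace ℝ (Fin p))
        (Ω : Type*) [MeasurableSpace Ω] (P : Measure Ω) [IsProbabilityMeasure P]
        (Y : Fin n → Ω → ℝ) (θs : EuclideanSpace ℝ (Fin p)) (dens : Fin n → ℝ → ℝ)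
        (ρ δ x : ℝ),
        0 < p →
        (LAD.V0sq Ψ).PosDef →
        (∀ i, Measurable (Y i)) →
        iIndepFun Y P →
        (∀ θ, ∫ ω, (LAD.logLik Ψ (fun i => Y i ω) θ - LAD.logLik Ψ (fun i => Y i ω) θs) ∂P ≤ 0) →
        (∀ i, Measurable (dens i)) →
        (∀ i u, 0 ≤ dens i u) →
        (∀ i, P.map (fun ω => Y i ω - inner ℝ (Ψ i) θs) =
          volume.withDensity (fun u => ENNReal.ofReal (dens i u))) →
        (∀ i, a ^ 2 / 4 ≤ dens i 0) →
        0 < ρ → 0 ≤ δ → δ < 1 / 2 →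
        (∀ i u, |u| ≤ ρ → |dens i u / dens i 0 - 1| ≤ δ) →
        0 < x →
        C₂ * ρ⁻¹ ^ 2 * a ^ 2 * (x + p) ≤ LAD.effN Ψ →
        ∃ A : Set Ω, MeasurableSet A ∧ 1 - Real.exp (-x) ≤ P.real A ∧
          ∀ ω ∈ A, ∀ θt : EuclideanSpace ℝ (Fin p),
            IsMaxOn (LAD.logLik Ψ (fun i => Y i ω)) Set.univ θt →
            ‖LAD.act (LAD.D0 Ψ dens) (θt - θs) - LAD.score Ψ dens θs (fun i => Y i ω)‖ ^ 2
                ≤ (K * δ + κ (LAD.effN Ψ / (x + p))) * (x + p) ∧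
            |2 * (LAD.logLik Ψ (fun i => Y i ω) θt - LAD.logLik Ψ (fun i => Y i ω) θs)
                - ‖LAD.score Ψ dens θs (fun i => Y i ω)‖ ^ 2|
                ≤ (K * δ + κ (LAD.effN Ψ / (x + p))) * (x + p) := by
  set ε₀ := min (1 / 16) (256 * a⁻¹ ^ 2 / LAD.expansionConst a⁻¹)
  have hconst : 0 < LAD.expansionConst a⁻¹ := by unfold LAD.expansionConst; positivity
  obtain ⟨C₂, hC₂, hscale⟩ := LAD.exists_forall_netScale_le ha (by positivity : 0 < ε₀)
  refine ⟨C₂, 2 ^ 13 * a⁻¹ ^ 2, fun t => 4 * LAD.expansionConst a⁻¹ * LAD.netScale a t, hC₂,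
    by positivity, by simpa using (LAD.tendsto_netScale ha).const_mul _, ?_⟩
  intro n p Ψ Ω _ P _ Y θs dens ρ δ x hp hV hY hind hmax hd hd0 hlaw hda hρ hδ0 hδ2 hδ hx hN
  have hN0 : 0 < LAD.effN Ψ := lt_of_lt_of_le (by positivity) hN
  have he : ∀ i, Measurable fun ω => Y i ω - inner ℝ (Ψ i) θs := fun i => (hY i).sub_const _
  obtain ⟨i⟩ := LAD.nonempty_of_effN_pos hN0
  have hwidth : ρ * a ^ 2 ≤ 4 := LAD.mul_le_four_of_abs_div_sub_one_le (he i) (hlaw i)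
    (by positivity) (hda i) hδ2.le (hδ i)
  obtain ⟨hερ, hεle⟩ := hscale ρ (LAD.effN Ψ / (x + p)) hρ hwidth
    ((le_div_iff₀ (by positivity)).2 hN)
  refine LAD.exists_measurableSet_of_ae
    (LAD.measureReal_not_fisherWilksExpansion_normFeature_le ha hp hV hY hind hmax hd hd0 hlaw hda
      hδ0 hδ2.le hδ hx hN0 hερ (hεle.trans (min_le_left _ _))
      ((le_div_iff₀ hconst).1 (hεle.trans (min_le_right _ _)))) ?_
  filter_upwards [LAD.ae_forall_ne_zero_of_map_eq_withDensity he hlaw] with ω hω hexp θt hθt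
  exact LAD.expansion_of_fisherWilksExpansion (LAD.posDef_D0sq hV fun i =>
    lt_of_lt_of_le (by positivity) (hda i)) hω hexp hθt

theorem mainTheorem12 (C a : ℝ) (hC : 0 < C) (ha : 0 < a) :
    ∃ (C₂ K : ℝ) (κ : ℝ → ℝ), 0 < C₂ ∧ 0 < K ∧ Tendsto κ atTop (𝓝 0) ∧
      ∀ (n p : ℕ) (Ψ : Fin n → EuclideanSpace ℝ (Fin p))
        (Ω : Type*) [MeasurableSpace Ω] (P : Measure Ω) [IsProbabilityMeasure P]
        (Y : Fin n → Ω → ℝ) (θs : EuclideanSpace ℝ (Fin p)) (dens : Fin n → ℝ → ℝ)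
        (ρ δ x : ℝ),
        0 < p →
        (LAD.V0sq Ψ).PosDef →
        -- independent observations
        (∀ i, Measurable (Y i)) →
        iIndepFun Y P →
        -- `θs` maximizes `E L(θ)`, written through the differences `E {L(θ) - L(θs)}`, which
        -- are finite even if the observations have no mean
        (∀ θ, ∫ ω, (LAD.logLik Ψ (fun i => Y i ω) θ - LAD.logLik Ψ (fun i => Y i ω) θs) ∂P ≤ 0) →
        -- `dens i` is a density of the residual `Y i - Ψᵢᵀ θs`
        (∀ i, Measurable (dens i)) →
        (∀ i u, 0 ≤ dens i u) →
        (∀ i, P.map (fun ω => Y i ω - inner ℝ (Ψ i) θs) =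
          volume.withDensity (fun u => ENNReal.ofReal (dens i u))) →
        -- the conditions on the densities
        (∀ i u, dens i u ≤ C) →
        (∀ i, a ^ 2 / 4 ≤ dens i 0) →
        0 < ρ → 0 < δ → δ < 1 / 2 →
        (∀ i u, |u| ≤ ρ → |dens i u / dens i 0 - 1| ≤ δ) →
        -- the condition on the effective sample size
        0 < x →
        C₂ * ρ⁻¹ ^ 2 * a ^ 2 * (x + p) ≤ LAD.effN Ψ →
        ∃ A : Set Ω, MeasurableSet A ∧ 1 - Real.exp (-x) ≤ P.real A ∧
          ∀ ω ∈ A, ∀ θt : EuclideanSpace ℝ (Fin p),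
            IsMaxOn (LAD.logLik Ψ (fun i => Y i ω)) Set.univ θt →
            ‖LAD.act (LAD.D0 Ψ dens) (θt - θs) - LAD.score Ψ dens θs (fun i => Y i ω)‖ ^ 2
                ≤ (K * δ + κ (LAD.effN Ψ / (x + p))) * (x + p) ∧
            |2 * (LAD.logLik Ψ (fun i => Y i ω) θt - LAD.logLik Ψ (fun i => Y i ω) θs)
                - ‖LAD.score Ψ dens θs (fun i => Y i ω)‖ ^ 2|
                ≤ (K * δ + κ (LAD.effN Ψ / (x + p))) * (x + p) := by
  obtain ⟨C₂, K, κ, hC₂, hK, hκ, h⟩ := mainTheorem12_general a ha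
  exact ⟨C₂, K, κ, hC₂, hK, hκ,
    fun n p Ψ Ω _ P _ Y θs dens ρ δ x hp hV hY hind hmax hd hd0 hlaw _ hda hρ hδ0 =>
      h n p Ψ Ω P Y θs dens ρ δ x hp hV hY hind hmax hd hd0 hlaw hda hρ hδ0.le⟩
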